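/- Let $\mathcal C$ be the ternary Cantor set and $E=\mathcal C^3\subset\mathbb R^3$. For $i\in\{0,1\}^3$ let $S_i(x)=\tfrac13x+\tfrac23 i$; the eight cubes $D_i=S_i([0,1]^3)$ are the basic sets of level 1. Let $s=\dim_{\rm H}E$ $(=3\log_3 2)$, let $\mu(A)=\mathcal H^s(A\cap E)/\mathcal H^s(E)$, let $c=\min_{i\ne j} d(S_i(E),S_j(E))$, and write $|A|$ for the Euclidean diameter of $A$. Call a convex set $A\subset\mathbb R^3$ with $c\le|A|\le|E|$ an optimal set of $\mathcal C^3$ if it minimizes $|A|^s/\mu(A)$ (understood as $+\infty$ if $\mu(A)=0$) among all such convex sets. Then: 1. There is an optimal set of $\mathcal C^3$ that meets at least five of the eight basic sets of level 1. 2. Every optimal set that meets at least two basic sets of level 1 meets at least five of them (in particular at least four). 3. If an optimal set $A$ meets fewer than two basic sets of level 1, then there is an $i$ with $A\cap E\subset D_i$ such that the magnified set $S_i^{-1}(A)$ is again optimal and meets at least five basic sets of level 1. -/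

import Mathlib

open MeasureTheory
open scoped ENNReal

noncomputable section

/-- The `d`-fold Cartesian product of the ternary Cantor set, in Euclidean space. -/
def cantorProd (d : ℕ) : Set (EuclideanSpace ℝ (Fin d)) :=
  {x | ∀ k, x k ∈ cantorSet}

/-- The similarity `x ↦ x / 3 + (2 / 3) i` attached to a vertex `i ∈ {0, 1}ᵈ`. -/
def cantorMap (d : ℕ) (i : Fin d → Fin 2) (x : EuclideanSpace ℝ (Fin d)) :
    EuclideanSpace ℝ (Fin d) :=
  (1 / 3 : ℝ) • x + (2 / 3 : ℝ) • WithLp.toLp 2 (fun k => ((i k : ℕ) : ℝ))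

/-- The closed unit cube `[0, 1]ᵈ`. -/
def unitCube (d : ℕ) : Set (EuclideanSpace ℝ (Fin d)) :=
  {x | ∀ k, x k ∈ Set.Icc (0 : ℝ) 1}

/-- The basic sets of level 1: the cubes `S_i([0, 1]ᵈ)`. -/
def basicCube (d : ℕ) (i : Fin d → Fin 2) : Set (EuclideanSpace ℝ (Fin d)) :=
  cantorMap d i '' unitCube d

/-- The Hausdorff dimension `s` of the `d`-fold product of the Cantor set. -/
def cantorDim (d : ℕ) : ℝ := (dimH (cantorProd d)).toReal

/-- The normalized Hausdorff measure `μ(A) = ℋˢ(A ∩ E) / ℋˢ(E)` with `E` the `d`-fold product of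
the Cantor set (as an outer measure, so for every set `A`). -/
def cantorMeasure (d : ℕ) (A : Set (EuclideanSpace ℝ (Fin d))) : ℝ≥0∞ :=
  μH[cantorDim d] (A ∩ cantorProd d) / μH[cantorDim d] (cantorProd d)

/-- The distance `inf {dist x y : x ∈ X, y ∈ Y}` between two sets. -/
def setDist {M : Type*} [MetricSpace M] (X Y : Set M) : ℝ :=
  sInf {r | ∃ x ∈ X, ∃ y ∈ Y, r = dist x y}

/-- The constant `c = min_{i ≠ j} d(S_i(E), S_j(E))`. -/
def cantorGap (d : ℕ) : ℝ :=
  ⨅ p : {p : (Fin d → Fin 2) × (Fin d → Fin 2) // p.1 ≠ p.2},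
    setDist (cantorMap d p.1.1 '' cantorProd d) (cantorMap d p.1.2 '' cantorProd d)

/-- The competitors: convex sets `A` with `c ≤ |A| ≤ |E|`, where `|·|` is the diameter. -/
def admissibleSets (d : ℕ) : Set (Set (EuclideanSpace ℝ (Fin d))) :=
  {A | Convex ℝ A ∧ ENNReal.ofReal (cantorGap d) ≤ Metric.ediam A ∧
    Metric.ediam A ≤ Metric.ediam (cantorProd d)}

/-- The quotient `|A|ˢ / μ(A)`; it is `∞` when `μ(A) = 0 < |A|`. -/
def diamRatio (d : ℕ) (A : Set (EuclideanSpace ℝ (Fin d))) : ℝ≥0∞ :=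
  Metric.ediam A ^ cantorDim d / cantorMeasure d A

/-- An optimal set is an admissible set at which `|A|ˢ / μ(A)` attains its minimum. -/
def IsOptimalSet (d : ℕ) (A : Set (EuclideanSpace ℝ (Fin d))) : Prop :=
  A ∈ admissibleSets d ∧ IsMinOn (diamRatio d) (admissibleSets d) A

/-- The number of level-1 basic sets which `A` intersects. -/
def numBasicMet (d : ℕ) (A : Set (EuclideanSpace ℝ (Fin d))) : ℕ :=
  Set.ncard {i : Fin d → Fin 2 | (A ∩ basicCube d i).Nonempty}

end

/-!
The ball around the centre of the unit cube whose diameter is `√14515 / 81` has mass at least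
`453 / 512`: all but `472` of the `4096` cells of level 4 lie in it. Hence every optimal set
satisfies `|A| ^ s ≤ testDiam ^ s * (512 / 453) * μ(A)`, so its mass bounds its diameter.

Cover the trace of such a set on the Cantor product by cells of level 3, that is, by eight octants
of 64 cells. If the trace meets two, three or four octants, any two of the cells must be closer than
the diameter allows, which limits the number of cells, hence the mass, hence the diameter again.
Iterating this descends until no cell is left, a contradiction. So at least five octants are met.

If the trace lies in a single octant, magnifying it by `3` preserves the ratio, because `3 ^ s = 8`.
The magnified set has diameter at least `1`, and a set which is that large and whose trace lies in a
single octant has too large a ratio. So the magnified set meets five octants. As its diameter is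
below `5 / 3`, the set itself cannot reach a second octant.

Optimal sets exist because the ultralimit of a minimizing sequence is closed and convex, and because
the mass is upper semicontinuous along such a limit.
-/
/-- The left endpoints `0, 2, 6, 8`, in units of `1 / 27`, of the four triadic intervals of length
`1 / 27` that make up a third of the Cantor set. They are measured from the end facing the
other third. -/
def cellOffset (j : Fin 4) : ℕ := 2 * j + 2 * (j / 2)

/-- The squared distance, in units of `1 / 27`, of two triadic intervals in different thirds of the
Cantor set; the facing ends of the thirds are at distance `9`. -/
def gapSq (i j : Fin 4) : ℕ := (9 + cellOffset i + cellOffset j) ^ 2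

/-- The squared distance of two cells of the plane in diagonally opposite squares. -/
def diagSq (x y : Fin 4 × Fin 4) : ℕ := gapSq x.1 y.1 + gapSq x.2 y.2

theorem cellOffset_mono : Monotone cellOffset := by
  decide

theorem gapSq_mono {i i' j j' : Fin 4} (hi : i ≤ i') (hj : j ≤ j') :
    gapSq i j ≤ gapSq i' j' := by
  have := cellOffset_mono hi
  have := cellOffset_mono hj
  unfold gapSq
  gcongr

theorem diagSq_mono {x x' y y' : Fin 4 × Fin 4} (hx : x ≤ x') (hy : y ≤ y') :
    diagSq x y ≤ diagSq x' y' :=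
  add_le_add (gapSq_mono hx.1 hy.1) (gapSq_mono hx.2 hy.2)

/-- The cells of the plane below the graph of `h`. -/
def staircase (h : Fin 4 → Fin 5) : Finset (Fin 4 × Fin 4) :=
  Finset.univ.filter fun x => x.2.castSucc < h x.1

/-- The height function of the smallest staircase containing `F` that descends to the right. -/
noncomputable def profile (F : Finset (Fin 4 × Fin 4)) (a : Fin 4) : Fin 5 :=
  (F.filter fun x => a ≤ x.1).sup fun x => x.2.succ

theorem profile_antitone (F : Finset (Fin 4 × Fin 4)) : Antitone (profile F) := by
  intro a b hab
  refine Finset.sup_mono fun x hx => ?_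
  rw [Finset.mem_filter] at hx ⊢
  exact ⟨hx.1, hab.trans hx.2⟩

theorem subset_staircase_profile (F : Finset (Fin 4 × Fin 4)) : F ⊆ staircase (profile F) := by
  intro x hx
  refine Finset.mem_filter.2 ⟨Finset.mem_univ _, Fin.castSucc_lt_succ.trans_le ?_⟩
  exact Finset.le_sup (f := fun x : Fin 4 × Fin 4 => x.2.succ)
    (Finset.mem_filter.2 ⟨hx, le_rfl⟩)

theorem exists_ge_of_mem_staircase_profile {F : Finset (Fin 4 × Fin 4)} {x : Fin 4 × Fin 4}
    (hx : x ∈ staircase (profile F)) : ∃ y ∈ F, x ≤ y := by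
  obtain ⟨y, hy, hxy⟩ := Finset.lt_sup_iff.1 (Finset.mem_filter.1 hx).2
  rw [Finset.mem_filter] at hy
  exact ⟨y, hy.1, hy.2, Fin.castSucc_lt_succ_iff.1 hxy⟩

/-- The cells of the opposite square at squared distance less than `T` from every cell in `S`. -/
def partnerCells (T : ℕ) (S : Finset (Fin 4 × Fin 4)) : Finset (Fin 4 × Fin 4) :=
  Finset.univ.filter fun y => ∀ x ∈ S, diagSq x y < T

/-- The nonzero descending height functions whose staircase has a partner cell. -/
def compatibleProfiles (T : ℕ) : Finset (Fin 4 → Fin 5) :=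
  Finset.univ.filter fun h =>
    Antitone h ∧ (staircase h).Nonempty ∧ (partnerCells T (staircase h)).Nonempty

/-- The largest total number of cells in two diagonally opposite squares, both occupied, when cells
in different squares are at squared distance less than `T`. -/
def pairMax (T : ℕ) : ℕ :=
  (compatibleProfiles T).sup fun h => (staircase h).card + (partnerCells T (staircase h)).card

/-- The cells of the square between two diagonally opposite ones that are at squared distance less
than `T` from the nonempty columns of the staircase of `h` in one of them and from the row `e` of
the other. -/
def cornerCells (T : ℕ) (h : Fin 4 → Fin 5) (e : Fin 4) : Finset (Fin 4 × Fin 4) :=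
  Finset.univ.filter fun z => (∀ a, h a ≠ 0 → gapSq z.1 a < T) ∧ gapSq z.2 e < T

/-- An upper bound for the total number of cells in three squares in the shape of an `L`, both ends
occupied, when cells in different squares are at squared distance less than `T`. -/
def tripleMax (T : ℕ) : ℕ :=
  (compatibleProfiles T).sup fun h => Finset.univ.sup fun e =>
    (cornerCells T h e).card + (staircase h).card +
      ((partnerCells T (staircase h)).filter fun y => y.2 ≤ e).card

section PlaneCells

variable {T : ℕ} {F G O : Finset (Fin 4 × Fin 4)}

theorem subset_partnerCells_staircase (h : ∀ x ∈ F, ∀ y ∈ G, diagSq x y < T) :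
    G ⊆ partnerCells T (staircase (profile F)) := by
  refine fun y hy => Finset.mem_filter.2 ⟨Finset.mem_univ _, fun x hx => ?_⟩
  obtain ⟨x', hx', hle⟩ := exists_ge_of_mem_staircase_profile hx
  exact (diagSq_mono hle le_rfl).trans_lt (h x' hx' y hy)

theorem profile_mem_compatibleProfiles (hF : F.Nonempty) (hG : G.Nonempty)
    (h : ∀ x ∈ F, ∀ y ∈ G, diagSq x y < T) :
    profile F ∈ compatibleProfiles T :=
  Finset.mem_filter.2 ⟨Finset.mem_univ _, profile_antitone F,
    hF.mono (subset_staircase_profile F), hG.mono (subset_partnerCells_staircase h)⟩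

theorem card_add_card_le_pairMax (hF : F.Nonempty) (hG : G.Nonempty)
    (h : ∀ x ∈ F, ∀ y ∈ G, diagSq x y < T) : F.card + G.card ≤ pairMax T :=
  (add_le_add (Finset.card_le_card (subset_staircase_profile F))
    (Finset.card_le_card (subset_partnerCells_staircase h))).trans
    (Finset.le_sup (f := fun h => (staircase h).card + (partnerCells T (staircase h)).card)
      (profile_mem_compatibleProfiles hF hG h))

theorem card_add_card_add_card_le_tripleMax (hF : F.Nonempty) (hG : G.Nonempty)
    (h : ∀ x ∈ F, ∀ y ∈ G, diagSq x y < T) (hOF : ∀ z ∈ O, ∀ x ∈ F, gapSq z.1 x.1 < T)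
    (hOG : ∀ z ∈ O, ∀ y ∈ G, gapSq z.2 y.2 < T) : O.card + F.card + G.card ≤ tripleMax T := by
  obtain ⟨y, hy, hmax⟩ := G.exists_max_image (fun y => y.2) hG
  have hO : O ⊆ cornerCells T (profile F) y.2 := by
    refine fun z hz => Finset.mem_filter.2 ⟨Finset.mem_univ _, fun a ha => ?_, hOG z hz y hy⟩
    have hmem : (a, 0) ∈ staircase (profile F) :=
      Finset.mem_filter.2 ⟨Finset.mem_univ _, Fin.pos_iff_ne_zero.2 ha⟩
    obtain ⟨x, hx, hle⟩ := exists_ge_of_mem_staircase_profile hmem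
    exact (gapSq_mono le_rfl hle.1).trans_lt (hOF z hz x hx)
  have hG' : G ⊆ (partnerCells T (staircase (profile F))).filter fun z => z.2 ≤ y.2 :=
    fun z hz => Finset.mem_filter.2 ⟨subset_partnerCells_staircase h hz, hmax z hz⟩
  have hcard := add_le_add (add_le_add (Finset.card_le_card hO)
    (Finset.card_le_card (subset_staircase_profile F))) (Finset.card_le_card hG')
  exact (hcard.trans (Finset.le_sup (f := fun e => (cornerCells T (profile F) e).card +
      (staircase (profile F)).card +
      ((partnerCells T (staircase (profile F))).filter fun z => z.2 ≤ e).card)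
      (Finset.mem_univ y.2))).trans
    (Finset.le_sup (f := fun h => Finset.univ.sup fun e => (cornerCells T h e).card +
      (staircase h).card + ((partnerCells T (staircase h)).filter fun z => z.2 ≤ e).card)
      (profile_mem_compatibleProfiles hF hG h))

end PlaneCells

/-- The projection of a set of cells of a cube to the plane of the coordinates `p` and `q`. -/
def planeCells (p q : Fin 3) (S : Finset (Fin 3 → Fin 4)) : Finset (Fin 4 × Fin 4) :=
  S.image fun c => (c p, c q)

theorem card_le_four_mul_card_planeCells {p q : Fin 3} (hpq : p ≠ q)
    (S : Finset (Fin 3 → Fin 4)) : S.card ≤ 4 * (planeCells p q S).card := by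
  have fiber : ∀ p q : Fin 3, p ≠ q → ∀ b : Fin 4 × Fin 4,
      (Finset.univ.filter fun c : Fin 3 → Fin 4 => (c p, c q) = b).card ≤ 4 := by
    decide +kernel
  refine Finset.card_le_mul_card_image S 4 fun b _ => ?_
  exact (Finset.card_le_card (Finset.filter_subset_filter _ (Finset.subset_univ S))).trans
    (fiber p q hpq b)

theorem card_cells_le (S : Finset (Fin 3 → Fin 4)) : S.card ≤ 64 :=
  (Finset.card_le_univ S).trans_eq (by simp)

section Cells

variable {T : ℕ} {p q : Fin 3} {O X Y : Finset (Fin 3 → Fin 4)}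

theorem card_add_card_le_four_mul_pairMax (hpq : p ≠ q) (hX : X.Nonempty) (hY : Y.Nonempty)
    (h : ∀ x ∈ X, ∀ y ∈ Y, diagSq (x p, x q) (y p, y q) < T) :
    X.card + Y.card ≤ 4 * pairMax T := by
  have key : (planeCells p q X).card + (planeCells p q Y).card ≤ pairMax T :=
    card_add_card_le_pairMax (hX.image _) (hY.image _)
      (by simpa only [planeCells, Finset.forall_mem_image] using h)
  have := card_le_four_mul_card_planeCells hpq X
  have := card_le_four_mul_card_planeCells hpq Y
  omega

theorem card_add_card_add_card_le_four_mul_tripleMax (hpq : p ≠ q) (hX : X.Nonempty)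
    (hY : Y.Nonempty) (h : ∀ x ∈ X, ∀ y ∈ Y, diagSq (x p, x q) (y p, y q) < T)
    (hOX : ∀ o ∈ O, ∀ x ∈ X, gapSq (o p) (x p) < T)
    (hOY : ∀ o ∈ O, ∀ y ∈ Y, gapSq (o q) (y q) < T) :
    O.card + X.card + Y.card ≤ 4 * tripleMax T := by
  have key : (planeCells p q O).card + (planeCells p q X).card + (planeCells p q Y).card ≤
      tripleMax T :=
    card_add_card_add_card_le_tripleMax (hX.image _) (hY.image _)
      (by simpa only [planeCells, Finset.forall_mem_image] using h)
      (by simpa only [planeCells, Finset.forall_mem_image] using hOX)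
      (by simpa only [planeCells, Finset.forall_mem_image] using hOY)
  have := card_le_four_mul_card_planeCells hpq O
  have := card_le_four_mul_card_planeCells hpq X
  have := card_le_four_mul_card_planeCells hpq Y
  omega

end Cells

/-- Some cell of `S` lies in the outer half in direction `p`. -/
def IsFar (p : Fin 3) (S : Finset (Fin 3 → Fin 4)) : Prop := ∃ x ∈ S, 2 ≤ x p

theorem card_le_of_not_isFar {p : Fin 3} {S : Finset (Fin 3 → Fin 4)} (h : ¬IsFar p S) :
    S.card ≤ 32 := by
  have half : ∀ p : Fin 3, (Finset.univ.filter fun c : Fin 3 → Fin 4 => c p < 2).card ≤ 32 := by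
    decide +kernel
  exact (Finset.card_le_card fun x hx => Finset.mem_filter.2
    ⟨Finset.mem_univ _, not_le.1 fun hp => h ⟨x, hx, hp⟩⟩).trans (half p)

theorem card_le_of_forall_not_isFar {S : Finset (Fin 3 → Fin 4)} (h : ∀ p, ¬IsFar p S) :
    S.card ≤ 8 := by
  have octant : (Finset.univ.filter fun c : Fin 3 → Fin 4 => ∀ p, c p < 2).card ≤ 8 := by
    decide +kernel
  exact (Finset.card_le_card fun x hx => Finset.mem_filter.2
    ⟨Finset.mem_univ _, fun p => not_le.1 fun hp => h p ⟨x, hx, hp⟩⟩).trans octant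

/-- The sets `O` and `X p` of cells of a cube and of its neighbours in the three directions `p` are
at squared distance less than `T`, as far as the coordinates in which two cubes differ show. -/
structure IsClaw (T : ℕ) (O : Finset (Fin 3 → Fin 4)) (X : Fin 3 → Finset (Fin 3 → Fin 4)) :
    Prop where
  nonempty : ∀ p, (X p).Nonempty
  diagSq_lt : ∀ p q, p ≠ q → ∀ x ∈ X p, ∀ y ∈ X q, diagSq (x p, x q) (y p, y q) < T
  gapSq_lt : ∀ p, ∀ o ∈ O, ∀ x ∈ X p, gapSq (o p) (x p) < T

/-- An upper bound for the number of cells in a neighbour of a cyclic claw, in which the neighbour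
in direction `p` reaches out in direction `p + e`. The triple `u` consists of the coordinates
`p`, `p + e` and `p - e` of a cell. -/
def cyclicMax (T : ℕ) : ℕ :=
  (Finset.univ.filter fun u : Fin 4 × Fin 4 × Fin 4 =>
    diagSq (u.1, u.2.1) (0, 0) < T ∧ diagSq (0, 2) (u.2.2, u.1) < T).card

/-- An upper bound for the number of cells of a claw. For `T ≤ 441`, two neighbours cannot both
reach out towards each other, and the cube cannot reach out towards a neighbour reaching away from
it. -/
def clawMax (T : ℕ) : ℕ :=
  let bound := min (64 + 6 * pairMax T) (4 * tripleMax T + 2 * pairMax T)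
  if T ≤ 441 then
    min bound (max (32 + 6 * pairMax T) (max (4 * tripleMax T + 8) (64 + 3 * cyclicMax T)))
  else bound

namespace IsClaw

variable {T : ℕ} {O : Finset (Fin 3 → Fin 4)} {X : Fin 3 → Finset (Fin 3 → Fin 4)}

theorem card_add_card_le (h : IsClaw T O X) {p q : Fin 3} (hpq : p ≠ q) :
    (X p).card + (X q).card ≤ 4 * pairMax T :=
  card_add_card_le_four_mul_pairMax hpq (h.nonempty p) (h.nonempty q) (h.diagSq_lt p q hpq)

theorem card_add_card_add_card_le (h : IsClaw T O X) {p q : Fin 3} (hpq : p ≠ q) :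
    O.card + (X p).card + (X q).card ≤ 4 * tripleMax T :=
  card_add_card_add_card_le_four_mul_tripleMax hpq (h.nonempty p) (h.nonempty q)
    (h.diagSq_lt p q hpq) (h.gapSq_lt p) (h.gapSq_lt q)

theorem sum_card_le (h : IsClaw T O X) : ∑ p, (X p).card ≤ 6 * pairMax T := by
  have h01 := h.card_add_card_le (p := 0) (q := 1) (by decide)
  have h02 := h.card_add_card_le (p := 0) (q := 2) (by decide)
  have h12 := h.card_add_card_le (p := 1) (q := 2) (by decide)
  rw [Fin.sum_univ_three]
  omega

theorem card_add_sum_card_le (h : IsClaw T O X) :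
    O.card + ∑ p, (X p).card ≤ 4 * tripleMax T + 2 * pairMax T := by
  have h01 := h.card_add_card_add_card_le (p := 0) (q := 1) (by decide)
  have h02 := h.card_add_card_add_card_le (p := 0) (q := 2) (by decide)
  have h12 := h.card_add_card_add_card_le (p := 1) (q := 2) (by decide)
  have hsum := h.sum_card_le
  rw [Fin.sum_univ_three] at hsum ⊢
  omega

theorem card_add_sum_card_le_of_card_le (h : IsClaw T O X) {p : Fin 3} {k : ℕ}
    (hp : (X p).card ≤ k) : O.card + ∑ p, (X p).card ≤ 4 * tripleMax T + k := by
  have h12 := h.card_add_card_add_card_le (p := p + 1) (q := p + 2) (by clear * -; revert p; decide)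
  have hsum : ∑ p, (X p).card = (X p).card + (X (p + 1)).card + (X (p + 2)).card := by
    rw [Fin.sum_univ_three]
    fin_cases p <;> simp <;> ring
  omega

theorem card_le_of_isFar (h : IsClaw T O X) (hT : T ≤ 441) {p : Fin 3} (hp : IsFar p (X p)) :
    O.card ≤ 32 := by
  obtain ⟨x, hx, hxp⟩ := hp
  refine card_le_of_not_isFar (p := p) ?_
  rintro ⟨o, ho, hop⟩
  have hlow : 441 ≤ gapSq (o p) (x p) := gapSq_mono (i := 2) (j := 2) hop hxp
  have hlt := h.gapSq_lt p o ho x hx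
  omega

theorem not_isFar_of_isFar (h : IsClaw T O X) (hT : T ≤ 441) {p q : Fin 3} (hpq : p ≠ q)
    (hp : IsFar q (X p)) : ¬IsFar p (X q) := by
  rintro ⟨y, hy, hyp⟩
  obtain ⟨x, hx, hxq⟩ := hp
  have hlow : 450 ≤ diagSq (x p, x q) (y p, y q) :=
    diagSq_mono (x := (0, 2)) (y := (2, 0)) ⟨Fin.zero_le _, hxq⟩ ⟨hyp, Fin.zero_le _⟩
  have hlt := h.diagSq_lt p q hpq x hx y hy
  omega

theorem exists_cyclic (h : IsClaw T O X) (hT : T ≤ 441) (hnear : ∀ p, ¬IsFar p (X p))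
    (hX : ∀ p, 8 < (X p).card) : ∃ e : Fin 3, e ≠ 0 ∧ ∀ p, IsFar (p + e) (X p) := by
  have far : ∀ p, IsFar (p + 1) (X p) ∨ IsFar (p + 2) (X p) := by
    intro p
    by_contra! hp
    refine (hX p).not_ge (card_le_of_forall_not_isFar fun q => ?_)
    obtain rfl | rfl | rfl : q = p ∨ q = p + 1 ∨ q = p + 2 := by clear * -; revert p q; decide
    exacts [hnear q, hp.1, hp.2]
  have next : ∀ p, IsFar (p + 1) (X p) → IsFar (p + 1 + 1) (X (p + 1)) := fun p hp =>
    (far (p + 1)).resolve_right (by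
      simpa [add_assoc] using h.not_isFar_of_isFar hT (p := p) (q := p + 1) (by simp) hp)
  by_cases hp : ∃ p, IsFar (p + 1) (X p)
  · obtain ⟨p, hp⟩ := hp
    refine ⟨1, by decide, fun q => ?_⟩
    obtain rfl | rfl | rfl : q = p ∨ q = p + 1 ∨ q = p + 1 + 1 := by clear * -; revert p q; decide
    exacts [hp, next p hp, next _ (next p hp)]
  · push Not at hp
    exact ⟨2, by decide, fun p => (far p).resolve_left (hp p)⟩

theorem card_le_cyclicMax (h : IsClaw T O X) {e : Fin 3} (he : e ≠ 0)
    (hfar : ∀ p, IsFar (p + e) (X p)) (p : Fin 3) : (X p).card ≤ cyclicMax T := by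
  refine Finset.card_le_card_of_injOn (fun x => (x p, x (p + e), x (p - e))) ?_ ?_
  · intro x hx
    obtain ⟨y, hy⟩ := h.nonempty (p + e)
    obtain ⟨z, hz, hzp⟩ := hfar (p - e)
    rw [sub_add_cancel] at hzp
    refine Finset.mem_coe.2 (Finset.mem_filter.2 ⟨Finset.mem_univ _, ?_, ?_⟩)
    · exact (diagSq_mono le_rfl ⟨Fin.zero_le _, Fin.zero_le _⟩).trans_lt
        (h.diagSq_lt p (p + e) (by simpa using he) x hx y hy)
    · exact (diagSq_mono (x := (0, 2)) ⟨Fin.zero_le _, hzp⟩ le_rfl).trans_lt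
        (h.diagSq_lt (p - e) p (by simpa using he) z hz x hx)
  · intro x _ y _ hxy
    simp only [Prod.mk.injEq] at hxy
    funext k
    obtain rfl | rfl | rfl : k = p ∨ k = p + e ∨ k = p - e := by
      clear * - he; revert p k e; decide
    exacts [hxy.1, hxy.2.1, hxy.2.2]

theorem card_add_sum_card_le_of_le (h : IsClaw T O X) (hT : T ≤ 441) :
    O.card + ∑ p, (X p).card ≤
      max (32 + 6 * pairMax T) (max (4 * tripleMax T + 8) (64 + 3 * cyclicMax T)) := by
  by_cases hout : ∃ p, IsFar p (X p)
  · obtain ⟨p, hp⟩ := hout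
    exact le_max_of_le_left (add_le_add (h.card_le_of_isFar hT hp) h.sum_card_le)
  by_cases hsmall : ∃ p, (X p).card ≤ 8
  · obtain ⟨p, hp⟩ := hsmall
    exact le_max_of_le_right (le_max_of_le_left (h.card_add_sum_card_le_of_card_le hp))
  push Not at hout hsmall
  obtain ⟨e, he, hfar⟩ := h.exists_cyclic hT hout hsmall
  refine le_max_of_le_right (le_max_of_le_right (add_le_add (card_cells_le O) ?_))
  simpa using Finset.sum_le_card_nsmul Finset.univ _ _ fun p _ => h.card_le_cyclicMax he hfar p

theorem card_add_sum_card_le_clawMax (h : IsClaw T O X) :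
    O.card + ∑ p, (X p).card ≤ clawMax T := by
  have hbound := le_min (add_le_add (card_cells_le O) h.sum_card_le) h.card_add_sum_card_le
  rw [clawMax]
  split_ifs with hT
  exacts [le_min hbound (h.card_add_sum_card_le_of_le hT), hbound]

end IsClaw

/-- The distance of two triadic intervals in the same third of the Cantor set, in units of
`1 / 27`; the truncated subtractions give `0` for `i = j`. -/
def innerGap (i j : Fin 4) : ℕ :=
  max (cellOffset i - cellOffset j - 1) (cellOffset j - cellOffset i - 1)

/-- The number of cells of the plane whose reflection is at squared distance less than `K`. -/
def reflectionDefect (K : ℕ) : ℕ :=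
  (Finset.univ.filter fun x : Fin 4 × Fin 4 =>
    innerGap x.1 x.1.rev ^ 2 + innerGap x.2 x.2.rev ^ 2 < K).card

theorem card_add_card_le_reflectionDefect {F G : Finset (Fin 4 × Fin 4)} {K : ℕ}
    (h : ∀ x ∈ F, ∀ y ∈ G, innerGap x.1 y.1 ^ 2 + innerGap x.2 y.2 ^ 2 < K) :
    F.card + G.card ≤ 16 + reflectionDefect K := by
  have inj : Function.Injective fun x : Fin 4 × Fin 4 => (x.1.rev, x.2.rev) := by
    intro x y hxy
    simpa [Prod.ext_iff] using hxy
  rw [← Finset.card_image_of_injective G inj, ← Finset.card_union_add_card_inter]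
  refine add_le_add ((Finset.card_le_univ _).trans_eq (by simp))
    (Finset.card_le_card fun x hx => ?_)
  rw [Finset.mem_inter, Finset.mem_image] at hx
  obtain ⟨hx, y, hy, rfl⟩ := hx
  exact Finset.mem_filter.2 ⟨Finset.mem_univ _, by simpa using h _ hx y hy⟩

/-- An upper bound for the number of cells in the slabs `i` and `j` of two adjacent cubes. -/
def slabPairMax (T : ℕ) (i j : Fin 4) : ℕ :=
  if gapSq i 0 < T ∨ gapSq 0 j < T then 16 + reflectionDefect (T - gapSq i j) else 0

/-- An upper bound for the number of cells in two adjacent cubes, from matching the slabs of one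
cube with those of the other by a reflection `i ↦ k - i` modulo `4`. -/
def adjacentMax (T : ℕ) : ℕ :=
  Finset.univ.inf' Finset.univ_nonempty fun k : Fin 4 => ∑ i, slabPairMax T i (k - i)

section Adjacent

variable {p q r : Fin 3} {X Y : Finset (Fin 3 → Fin 4)}

/-- The slab of `S` of index `j` in direction `p`, in the coordinates `q` and `r`. -/
def slab (p q r : Fin 3) (S : Finset (Fin 3 → Fin 4)) (j : Fin 4) : Finset (Fin 4 × Fin 4) :=
  planeCells q r (S.filter fun c => c p = j)

theorem forall_mem_slab {j : Fin 4} {P : Fin 4 × Fin 4 → Prop} :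
    (∀ x ∈ slab p q r X j, P x) ↔ ∀ x ∈ X, x p = j → P (x q, x r) := by
  simp only [slab, planeCells, Finset.forall_mem_image, Finset.mem_filter, and_imp]

theorem slab_eq_empty_iff {j : Fin 4} : slab p q r X j = ∅ ↔ ∀ x ∈ X, x p ≠ j := by
  simp only [Finset.eq_empty_iff_forall_notMem, forall_mem_slab (P := fun _ => False)]

theorem card_eq_sum_slab (hall : ∀ k, k = p ∨ k = q ∨ k = r) (S : Finset (Fin 3 → Fin 4)) :
    S.card = ∑ j, (slab p q r S j).card := by
  rw [Finset.card_eq_sum_card_fiberwise (f := fun c => c p) (t := Finset.univ) (by simp)]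
  refine Finset.sum_congr rfl fun j _ => (Finset.card_image_of_injOn fun c hc d hd hcd => ?_).symm
  have hcp := (Finset.mem_filter.1 (Finset.mem_coe.1 hc)).2
  have hdp := (Finset.mem_filter.1 (Finset.mem_coe.1 hd)).2
  funext k
  rcases hall k with rfl | rfl | rfl
  exacts [hcp.trans hdp.symm, congrArg Prod.fst hcd, congrArg Prod.snd hcd]

variable {T : ℕ}

theorem card_slab_add_card_slab_le (hX : X.Nonempty) (hY : Y.Nonempty)
    (h : ∀ x ∈ X, ∀ y ∈ Y,
      gapSq (x p) (y p) + (innerGap (x q) (y q) ^ 2 + innerGap (x r) (y r) ^ 2) < T)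
    (i j : Fin 4) :
    (slab p q r X i).card + (slab p q r Y j).card ≤ slabPairMax T i j := by
  rw [slabPairMax]
  split_ifs with hij
  · refine card_add_card_le_reflectionDefect ?_
    simp only [forall_mem_slab]
    rintro x hx rfl y hy rfl
    have := h x hx y hy
    omega
  · push Not at hij
    obtain ⟨x', hx'⟩ := hX
    obtain ⟨y', hy'⟩ := hY
    have hXi : slab p q r X i = ∅ := slab_eq_empty_iff.2 fun x hx hxi => by
      have hlow : gapSq i 0 ≤ gapSq (x p) (y' p) := gapSq_mono hxi.ge (Fin.zero_le _)
      have := h x hx y' hy'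
      omega
    have hYj : slab p q r Y j = ∅ := slab_eq_empty_iff.2 fun y hy hyj => by
      have hlow : gapSq 0 j ≤ gapSq (x' p) (y p) := gapSq_mono (Fin.zero_le _) hyj.ge
      have := h x' hx' y hy
      omega
    simp [hXi, hYj]

theorem card_add_card_le_adjacentMax (hall : ∀ k, k = p ∨ k = q ∨ k = r) (hX : X.Nonempty)
    (hY : Y.Nonempty) (h : ∀ x ∈ X, ∀ y ∈ Y,
      gapSq (x p) (y p) + (innerGap (x q) (y q) ^ 2 + innerGap (x r) (y r) ^ 2) < T) :
    X.card + Y.card ≤ adjacentMax T := by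
  refine Finset.le_inf' _ _ fun k _ => ?_
  rw [card_eq_sum_slab hall X, card_eq_sum_slab hall Y,
    ← (Equiv.subLeft k).sum_comp fun j => (slab p q r Y j).card, ← Finset.sum_add_distrib]
  exact Finset.sum_le_sum fun i _ => card_slab_add_card_slab_le hX hY h i (k - i)

end Adjacent

/-- A set of `m` cells containing the trace of an efficient set forces the squared diameter of that
trace, in units of `1 / 27`, to be less than `T`. The numbers come from the competing ball, which
has mass at least `453 / 512` and squared diameter `14515 / 9` in these units, and from the
estimate `53 / 28` for the dimension `s`. -/
def Forces (m T : ℕ) : Prop :=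
  9 * T ≤ 14515 ∧ m ^ 56 * 14515 ^ 53 < (9 * T) ^ 53 * 453 ^ 56

instance (m T : ℕ) : Decidable (Forces m T) := by
  unfold Forces; infer_instance

theorem Forces.of_le {m M T : ℕ} (h : Forces M T) (hmM : m ≤ M) : Forces m T :=
  ⟨h.1, lt_of_le_of_lt (by gcongr) h.2⟩

/-- Alternating between the bound on the diameter forced by the number `M` of cells and the bound
`f T` on the number of cells of diameter less than `T`, along the given thresholds, leaves no
cell. -/
def Descends (f : ℕ → ℕ) : ℕ → List ℕ → Prop
  | M, [] => M = 0
  | M, T :: l => Forces M T ∧ Descends f (f T) l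

instance decidableDescends (f : ℕ → ℕ) : ∀ M l, Decidable (Descends f M l)
  | M, [] => inferInstanceAs (Decidable (M = 0))
  | M, T :: l => haveI := decidableDescends f (f T) l
    inferInstanceAs (Decidable (Forces M T ∧ Descends f (f T) l))

theorem Descends.eq_zero {P : ℕ → Prop} {f : ℕ → ℕ} {m : ℕ} (hP : ∀ T, Forces m T → P T)
    (hf : ∀ T, P T → m ≤ f T) : ∀ {l : List ℕ} {M : ℕ}, m ≤ M → Descends f M l → m = 0
  | [], _, hM, h => Nat.le_zero.1 (hM.trans_eq h)
  | T :: _, _, hM, h => Descends.eq_zero hP hf (hf T (hP T (h.1.of_le hM))) h.2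

/-- The thresholds for the squared diameter used when two of the cubes met are not adjacent. -/
def diagonalThresholds : List ℕ :=
  [883, 752, 666, 602, 538, 509, 460, 439, 418, 369, 348, 334, 307, 286, 204, 162]

theorem descends_diagonal :
    Descends (fun T => 8 * pairMax T) 256 diagonalThresholds ∧
      Descends (fun T => 4 * tripleMax T) 192 diagonalThresholds ∧
        Descends clawMax 256 diagonalThresholds := by
  decide +kernel

theorem descends_adjacent :
    Descends adjacentMax 128 [425, 314, 259, 204, 164, 125, 99, 81] := by
  decide +kernel

/-- The vertices `a` and `b` of the cube differ in at least two coordinates. -/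
def IsDiagonal (a b : Fin 3 → Fin 2) : Prop :=
  ∃ p q, p ≠ q ∧ a p ≠ b p ∧ a q ≠ b q

/-- The vertex `o` lies between the vertices `a` and `b` like the corner of an `L` between its two
ends. -/
def IsElbow (o a b : Fin 3 → Fin 2) : Prop :=
  ∃ p q, p ≠ q ∧ o p ≠ a p ∧ o q ≠ b q ∧ a p ≠ b p ∧ a q ≠ b q

/-- The neighbour of the vertex `o` of the cube in direction `p`. -/
def neighbour (o : Fin 3 → Fin 2) (p : Fin 3) : Fin 3 → Fin 2 := Function.update o p (o p + 1)

instance (a b : Fin 3 → Fin 2) : Decidable (IsDiagonal a b) := by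
  unfold IsDiagonal; infer_instance

instance (o a b : Fin 3 → Fin 2) : Decidable (IsElbow o a b) := by
  unfold IsElbow; infer_instance

theorem isDiagonal_or_adjacent : ∀ a b : Fin 3 → Fin 2, a ≠ b → IsDiagonal a b ∨
    ∃ p q r, (q ≠ p ∧ r ≠ p ∧ q ≠ r) ∧ a p ≠ b p ∧ a q = b q ∧ a r = b r := by
  decide +kernel

theorem neighbour_injective : ∀ o, Function.Injective (neighbour o) := by
  unfold Function.Injective
  decide +kernel

theorem neighbour_ne : ∀ o p, o ≠ neighbour o p := by
  decide +kernel

theorem neighbour_apply_ne : ∀ o p, o p ≠ neighbour o p p := by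
  decide +kernel

theorem neighbour_apply_ne_neighbour : ∀ o p q, p ≠ q → neighbour o p p ≠ neighbour o q p := by
  decide +kernel

theorem exists_isElbow {V : Finset (Fin 3 → Fin 2)} (hV : V.card = 3) :
    ∃ o a b, V = {o, a, b} ∧ o ∉ ({a, b} : Finset _) ∧ a ≠ b ∧ IsElbow o a b := by
  have cases : ∀ a b c : Fin 3 → Fin 2, a ≠ b → a ≠ c → b ≠ c →
      IsElbow a b c ∨ IsElbow b a c ∨ IsElbow c a b := by
    decide +kernel
  obtain ⟨a, b, c, hab, hac, hbc, rfl⟩ := Finset.card_eq_three.1 hV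
  rcases cases a b c hab hac hbc with h | h | h
  · exact ⟨a, b, c, rfl, by simp [*], hbc, h⟩
  · exact ⟨b, a, c, by grind, by simp [*, hab.symm], hac, h⟩
  · exact ⟨c, a, b, by grind, by simp [*, hac.symm, hbc.symm], hab, h⟩

theorem exists_isDiagonal_or_neighbours {V : Finset (Fin 3 → Fin 2)} (hV : V.card = 4) :
    (∃ a b c d, V = {a, b} ∪ {c, d} ∧ Disjoint ({a, b} : Finset _) {c, d} ∧
      IsDiagonal a b ∧ IsDiagonal c d) ∨ ∃ o, V = insert o (Finset.univ.image (neighbour o)) := by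
  have cases : ∀ a b c d : Fin 3 → Fin 2, a ≠ b → a ≠ c → a ≠ d → b ≠ c → b ≠ d → c ≠ d →
      (IsDiagonal a b ∧ IsDiagonal c d) ∨ (IsDiagonal a c ∧ IsDiagonal b d) ∨
        (IsDiagonal a d ∧ IsDiagonal b c) ∨
          ∃ o, {a, b, c, d} = insert o (Finset.univ.image (neighbour o)) := by
    decide +kernel
  obtain ⟨a, b, c, d, hab, hac, had, hbc, hbd, hcd, rfl⟩ := Finset.card_eq_four.1 hV
  rcases cases a b c d hab hac had hbc hbd hcd with h | h | h | h
  · exact .inl ⟨a, b, c, d, by grind, by simp [*, Ne.symm], h⟩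
  · exact .inl ⟨a, c, b, d, by grind, by simp [*, Ne.symm], h⟩
  · exact .inl ⟨a, d, b, c, by grind, by simp [*, Ne.symm], h⟩
  · exact .inr h

/-- A lower bound, in units of `1 / 27`, for the distance of points in the cells `i` and `j` of the
thirds `u` and `v` of the Cantor set. -/
def cellGap (u v : Fin 2) (i j : Fin 4) : ℕ :=
  if u = v then innerGap i j else 9 + cellOffset i + cellOffset j

/-- The cells in the sets `occ v`, one for each vertex `v` of the cube, are pairwise at squared
distance less than `T`, in units of `1 / 27`. -/
def CellsWithin (T : ℕ) (occ : (Fin 3 → Fin 2) → Finset (Fin 3 → Fin 4)) : Prop :=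
  ∀ a b, ∀ x ∈ occ a, ∀ y ∈ occ b, ∑ k, cellGap (a k) (b k) (x k) (y k) ^ 2 < T

namespace CellsWithin

variable {T : ℕ} {occ : (Fin 3 → Fin 2) → Finset (Fin 3 → Fin 4)} {o a b : Fin 3 → Fin 2}
  {p q r : Fin 3} {x y : Fin 3 → Fin 4}

theorem gapSq_lt (h : CellsWithin T occ) (hp : a p ≠ b p) (hx : x ∈ occ a) (hy : y ∈ occ b) :
    gapSq (x p) (y p) < T := by
  have hle := Finset.single_le_sum (f := fun k => cellGap (a k) (b k) (x k) (y k) ^ 2)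
    (fun _ _ => Nat.zero_le _) (Finset.mem_univ p)
  simp only [cellGap, if_neg hp] at hle
  exact hle.trans_lt (h a b x hx y hy)

theorem diagSq_lt (h : CellsWithin T occ) (hpq : p ≠ q) (hp : a p ≠ b p) (hq : a q ≠ b q)
    (hx : x ∈ occ a) (hy : y ∈ occ b) : diagSq (x p, x q) (y p, y q) < T := by
  have hle := Finset.sum_le_univ_sum_of_nonneg (s := {p, q})
    (f := fun k => cellGap (a k) (b k) (x k) (y k) ^ 2) (fun _ => Nat.zero_le _)
  rw [Finset.sum_pair hpq, cellGap, if_neg hp, cellGap, if_neg hq] at hle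
  exact hle.trans_lt (h a b x hx y hy)

theorem gapSq_add_lt (h : CellsWithin T occ) (hpqr : q ≠ p ∧ r ≠ p ∧ q ≠ r) (hp : a p ≠ b p)
    (hq : a q = b q) (hr : a r = b r) (hx : x ∈ occ a) (hy : y ∈ occ b) :
    gapSq (x p) (y p) + (innerGap (x q) (y q) ^ 2 + innerGap (x r) (y r) ^ 2) < T := by
  have hle := Finset.sum_le_univ_sum_of_nonneg (s := {p, q, r})
    (f := fun k => cellGap (a k) (b k) (x k) (y k) ^ 2) (fun _ => Nat.zero_le _)
  rw [Finset.sum_insert (by simp [hpqr.1.symm, hpqr.2.1.symm]), Finset.sum_pair hpqr.2.2, cellGap,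
    if_neg hp, cellGap, if_pos hq, cellGap, if_pos hr] at hle
  exact hle.trans_lt (h a b x hx y hy)

theorem card_add_card_le_four_mul_pairMax (h : CellsWithin T occ) (hab : IsDiagonal a b)
    (ha : (occ a).Nonempty) (hb : (occ b).Nonempty) :
    (occ a).card + (occ b).card ≤ 4 * pairMax T := by
  obtain ⟨p, q, hpq, hp, hq⟩ := hab
  exact _root_.card_add_card_le_four_mul_pairMax hpq ha hb
    fun x hx y hy => h.diagSq_lt hpq hp hq hx hy

theorem card_add_card_add_card_le_four_mul_tripleMax (h : CellsWithin T occ)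
    (hoab : IsElbow o a b) (ha : (occ a).Nonempty) (hb : (occ b).Nonempty) :
    (occ o).card + (occ a).card + (occ b).card ≤ 4 * tripleMax T := by
  obtain ⟨p, q, hpq, hoa, hob, hp, hq⟩ := hoab
  exact _root_.card_add_card_add_card_le_four_mul_tripleMax hpq ha hb
    (fun x hx y hy => h.diagSq_lt hpq hp hq hx hy) (fun z hz x hx => h.gapSq_lt hoa hz hx)
    (fun z hz y hy => h.gapSq_lt hob hz hy)

theorem isClaw (h : CellsWithin T occ) (hne : ∀ p, (occ (neighbour o p)).Nonempty) :
    IsClaw T (occ o) fun p => occ (neighbour o p) where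
  nonempty := hne
  diagSq_lt p q hpq _ hx _ hy := h.diagSq_lt hpq (neighbour_apply_ne_neighbour o p q hpq)
    (neighbour_apply_ne_neighbour o q p hpq.symm).symm hx hy
  gapSq_lt p _ hz _ hx := h.gapSq_lt (neighbour_apply_ne o p) hz hx

end CellsWithin

section CardVertices

variable {V : Finset (Fin 3 → Fin 2)} {occ : (Fin 3 → Fin 2) → Finset (Fin 3 → Fin 4)}

theorem sum_card_eq_zero_of_card_eq_two (hV : V.card = 2) (hne : ∀ v ∈ V, (occ v).Nonempty)
    (hocc : ∀ T, Forces (∑ v ∈ V, (occ v).card) T → CellsWithin T occ) :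
    ∑ v ∈ V, (occ v).card = 0 := by
  obtain ⟨a, b, hab, rfl⟩ := Finset.card_eq_two.1 hV
  have ha := hne a (by simp)
  have hb := hne b (by simp)
  have hcard := add_le_add (card_cells_le (occ a)) (card_cells_le (occ b))
  rw [Finset.sum_pair hab] at hocc ⊢
  rcases isDiagonal_or_adjacent a b hab with h | ⟨p, q, r, hpqr, hp, hq, hr⟩
  · refine Descends.eq_zero hocc (fun T hT => ?_) (by omega) descends_diagonal.1
    exact (hT.card_add_card_le_four_mul_pairMax h ha hb).trans (by gcongr; norm_num)
  · refine Descends.eq_zero hocc (fun T hT => ?_) hcard descends_adjacent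
    have hall : ∀ k, k = p ∨ k = q ∨ k = r := by clear * - hpqr; revert p q r; decide
    exact card_add_card_le_adjacentMax hall ha hb
      fun x hx y hy => hT.gapSq_add_lt hpqr hp hq hr hx hy

theorem sum_card_eq_zero_of_card_eq_three (hV : V.card = 3) (hne : ∀ v ∈ V, (occ v).Nonempty)
    (hocc : ∀ T, Forces (∑ v ∈ V, (occ v).card) T → CellsWithin T occ) :
    ∑ v ∈ V, (occ v).card = 0 := by
  obtain ⟨o, a, b, rfl, ho, hab, h⟩ := exists_isElbow hV
  have ha := hne a (by simp)
  have hb := hne b (by simp)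
  have hcard := add_le_add (add_le_add (card_cells_le (occ o)) (card_cells_le (occ a)))
    (card_cells_le (occ b))
  rw [Finset.sum_insert ho, Finset.sum_pair hab, ← add_assoc] at hocc ⊢
  exact Descends.eq_zero hocc
    (fun T hT => hT.card_add_card_add_card_le_four_mul_tripleMax h ha hb) hcard
    descends_diagonal.2.1

theorem sum_card_eq_zero_of_card_eq_four (hV : V.card = 4) (hne : ∀ v ∈ V, (occ v).Nonempty)
    (hocc : ∀ T, Forces (∑ v ∈ V, (occ v).card) T → CellsWithin T occ) :
    ∑ v ∈ V, (occ v).card = 0 := by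
  have hcard : ∑ v ∈ V, (occ v).card ≤ 256 :=
    (Finset.sum_le_card_nsmul V _ 64 fun v _ => card_cells_le (occ v)).trans (by simp [hV])
  rcases exists_isDiagonal_or_neighbours hV with ⟨a, b, c, d, rfl, hdisj, hab, hcd⟩ | ⟨o, rfl⟩
  · refine Descends.eq_zero hocc (fun T hT => ?_) hcard descends_diagonal.1
    rw [Finset.sum_union hdisj, Finset.sum_pair (by rintro rfl; simp [IsDiagonal] at hab),
      Finset.sum_pair (by rintro rfl; simp [IsDiagonal] at hcd)]
    have := hT.card_add_card_le_four_mul_pairMax hab (hne a (by simp)) (hne b (by simp))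
    have := hT.card_add_card_le_four_mul_pairMax hcd (hne c (by simp)) (hne d (by simp))
    omega
  · refine Descends.eq_zero hocc (fun T hT => ?_) hcard descends_diagonal.2.2
    rw [Finset.sum_insert (by simpa using fun p => (neighbour_ne o p).symm),
      Finset.sum_image fun _ _ _ _ h => neighbour_injective o h]
    exact (hT.isClaw fun p => hne _ (by simp)).card_add_sum_card_le_clawMax

theorem four_lt_card_of_forces (hV : 2 ≤ V.card) (hne : ∀ v ∈ V, (occ v).Nonempty)
    (hocc : ∀ T, Forces (∑ v ∈ V, (occ v).card) T → CellsWithin T occ) : 4 < V.card := by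
  by_contra! hV4
  have hzero : ∑ v ∈ V, (occ v).card = 0 := by
    obtain hV | hV | hV : V.card = 2 ∨ V.card = 3 ∨ V.card = 4 := by omega
    exacts [sum_card_eq_zero_of_card_eq_two hV hne hocc,
      sum_card_eq_zero_of_card_eq_three hV hne hocc, sum_card_eq_zero_of_card_eq_four hV hne hocc]
  obtain ⟨v, hv⟩ := Finset.card_pos.1 (zero_lt_two.trans_le hV)
  exact (hne v hv).card_ne_zero (Finset.sum_eq_zero_iff.1 hzero v hv)

end CardVertices

section CantorFunction

theorem cantorToBinary_succ (x : ℝ) (n : ℕ) :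
    (cantorToBinary x).get (n + 1) = (cantorToBinary (cantorStep x)).get n := by
  simp only [cantorToBinary, cantorSequence, Stream'.get_map, Stream'.get_succ_iterate]

theorem mem_cantorSet_iff {x : ℝ} :
    x ∈ cantorSet ↔ 3 * x ∈ cantorSet ∨ 3 * x - 2 ∈ cantorSet := by
  conv_lhs => rw [cantorSet_eq_union_halves]
  constructor
  · rintro (⟨y, hy, rfl⟩ | ⟨y, hy, rfl⟩)
    · exact .inl (by convert hy using 1; ring)
    · exact .inr (by convert hy using 1; ring)
  · rintro (h | h)
    · exact .inl ⟨_, h, by ring⟩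
    · exact .inr ⟨_, h, by ring⟩

theorem one_mem_cantorSet : (1 : ℝ) ∈ cantorSet := by
  refine Set.mem_iInter.2 fun n => ?_
  induction n with
  | zero => exact Set.right_mem_Icc.2 zero_le_one
  | succ n ih => exact .inr ⟨1, ih, by norm_num⟩

theorem mem_Icc_thirds_of_mem_cantorSet {x : ℝ} (hx : x ∈ cantorSet) :
    x ∈ Set.Icc 0 (1 / 3) ∨ x ∈ Set.Icc (2 / 3) 1 := by
  simp only [Set.mem_Icc]
  rcases mem_cantorSet_iff.1 hx with h | h <;> obtain ⟨h0, h1⟩ := cantorSet_subset_unitInterval h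
  · exact .inl ⟨by linarith, by linarith⟩
  · exact .inr ⟨by linarith, by linarith⟩

theorem mem_Icc_third_iff_of_abs_sub_lt {x y : ℝ} (hx : x ∈ cantorSet) (hy : y ∈ cantorSet)
    (h : |x - y| < 1 / 3) : x ∈ Set.Icc (0 : ℝ) (1 / 3) ↔ y ∈ Set.Icc (0 : ℝ) (1 / 3) := by
  rw [abs_lt] at h
  have hx' := mem_Icc_thirds_of_mem_cantorSet hx
  have hy' := mem_Icc_thirds_of_mem_cantorSet hy
  simp only [Set.mem_Icc] at hx' hy' ⊢
  constructor <;> rintro ⟨_, _⟩ <;> constructor <;> grind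

theorem cantorToBinary_eq_of_abs_sub_lt {n : ℕ} {x y : ℝ} (hx : x ∈ cantorSet)
    (hy : y ∈ cantorSet) (h : |x - y| < (3 ^ n)⁻¹) {i : ℕ} (hi : i < n) :
    (cantorToBinary x).get i = (cantorToBinary y).get i := by
  induction n generalizing x y i with
  | zero => exact absurd hi i.not_lt_zero
  | succ n ih =>
    rw [pow_succ, mul_inv] at h
    have hthird : |x - y| < 1 / 3 := h.trans_le <| by
      rw [one_div]
      exact mul_le_of_le_one_left (by norm_num) (inv_le_one_of_one_le₀ (one_le_pow₀ (by norm_num)))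
    have hiff := mem_Icc_third_iff_of_abs_sub_lt hx hy hthird
    rcases i with _ | i
    · simp only [cantorToBinary, cantorSequence, Stream'.get_map, Stream'.get_zero_iterate, hiff]
      congr
    · rw [cantorToBinary_succ, cantorToBinary_succ]
      refine ih (cantorStep_mem_cantorSet hx) (cantorStep_mem_cantorSet hy) ?_ (by omega)
      have hstep : cantorStep x - cantorStep y = 3 * (x - y) := by
        simp only [cantorStep, hiff]
        split_ifs <;> ring
      rw [hstep, abs_mul, abs_of_pos (by norm_num : (0 : ℝ) < 3)]
      linarith

/-- The Cantor function on the Cantor set: the ternary digits `0` and `2` are read as the binary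
digits `0` and `1`. It is used to bound Hausdorff measures from below. -/
noncomputable def cantorFunction (x : ℝ) : ℝ :=
  Real.ofDigits (b := 2) fun n => cond ((cantorToBinary x).get n) 1 0

theorem abs_cantorFunction_sub_le_of_abs_sub_lt {n : ℕ} {x y : ℝ} (hx : x ∈ cantorSet)
    (hy : y ∈ cantorSet) (h : |x - y| < (3 ^ n)⁻¹) :
    |cantorFunction x - cantorFunction y| ≤ (2 ^ n)⁻¹ := by
  have := Real.abs_ofDigits_sub_ofDigits_le (b := 2) (n := n)
    (x := fun n => cond ((cantorToBinary x).get n) 1 0)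
    (y := fun n => cond ((cantorToBinary y).get n) 1 0)
    fun i hi => by simp only [cantorToBinary_eq_of_abs_sub_lt hx hy h hi]
  exact_mod_cast this

theorem exists_cantorFunction_eq {y : ℝ} (hy : y ∈ Set.Ico (0 : ℝ) 1) :
    ∃ x ∈ cantorSet, cantorFunction x = y := by
  set bits : ℕ → Bool := fun n => decide (Real.digits y 2 n = 1)
  have hbits : (cantorToBinary (cantorSetEquivNatToBool.symm bits : ℝ)).get = bits :=
    cantorSetEquivNatToBool.apply_symm_apply bits
  have hdigit : ∀ c : Fin 2, (bif decide (c = 1) then (1 : Fin 2) else 0) = c := by decide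
  refine ⟨cantorSetEquivNatToBool.symm bits, (cantorSetEquivNatToBool.symm bits).2, ?_⟩
  rw [← Real.ofDigits_digits (b := 2) (by norm_num) hy, cantorFunction]
  exact congrArg Real.ofDigits (funext fun n => by rw [congrFun hbits n]; exact hdigit _)

theorem logb_three_two_pos : 0 < Real.logb 3 2 := Real.logb_pos (by norm_num) (by norm_num)

theorem inv_three_pow_rpow_logb (n : ℕ) :
    ((3 : ℝ) ^ n)⁻¹ ^ Real.logb 3 2 = ((2 : ℝ) ^ n)⁻¹ := by
  rw [Real.inv_rpow (by positivity), ← Real.rpow_natCast, ← Real.rpow_mul (by norm_num), mul_comm,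
    Real.rpow_mul (by norm_num), Real.rpow_logb (by norm_num) (by norm_num) (by norm_num),
    Real.rpow_natCast]

theorem abs_cantorFunction_sub_le_of_abs_sub_le {n : ℕ} {x y : ℝ} (hx : x ∈ cantorSet)
    (hy : y ∈ cantorSet) (h : |x - y| ≤ (3 ^ n)⁻¹) :
    |cantorFunction x - cantorFunction y| ≤ 2 * (2 ^ n)⁻¹ := by
  rcases n with _ | n
  · have h2 : (1 : ℝ) ≤ 2 * (2 ^ 0)⁻¹ := by norm_num
    refine le_trans (abs_le.2 ⟨?_, ?_⟩) h2 <;>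
      linarith [Real.ofDigits_nonneg (b := 2) fun n => cond ((cantorToBinary x).get n) 1 0,
        Real.ofDigits_le_one (b := 2) fun n => cond ((cantorToBinary x).get n) 1 0,
        Real.ofDigits_nonneg (b := 2) fun n => cond ((cantorToBinary y).get n) 1 0,
        Real.ofDigits_le_one (b := 2) fun n => cond ((cantorToBinary y).get n) 1 0,
        cantorFunction.eq_1 x, cantorFunction.eq_1 y]
  · have hlt : ((3 : ℝ) ^ (n + 1))⁻¹ < (3 ^ n)⁻¹ :=
      inv_strictAnti₀ (by positivity) (pow_lt_pow_right₀ (by norm_num) n.lt_succ_self)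
    refine (abs_cantorFunction_sub_le_of_abs_sub_lt hx hy (h.trans_lt hlt)).trans_eq ?_
    rw [pow_succ]
    field_simp

theorem abs_cantorFunction_sub_le {x y : ℝ} (hx : x ∈ cantorSet) (hy : y ∈ cantorSet) :
    |cantorFunction x - cantorFunction y| ≤ 4 * |x - y| ^ Real.logb 3 2 := by
  rcases eq_or_ne x y with rfl | hne
  · simp only [sub_self, abs_zero]; positivity
  have hle : |x - y| ≤ 1 := by
    obtain ⟨hx0, hx1⟩ := cantorSet_subset_unitInterval hx
    obtain ⟨hy0, hy1⟩ := cantorSet_subset_unitInterval hy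
    exact abs_le.2 ⟨by linarith, by linarith⟩
  obtain ⟨n, hlow, hup⟩ := exists_nat_pow_near_of_lt_one (abs_pos.2 (sub_ne_zero.2 hne)) hle
    (y := (3 : ℝ)⁻¹) (by norm_num) (by norm_num)
  rw [inv_pow] at hlow hup
  calc |cantorFunction x - cantorFunction y| ≤ 2 * (2 ^ n)⁻¹ :=
        abs_cantorFunction_sub_le_of_abs_sub_le hx hy hup
    _ = 4 * ((3 : ℝ) ^ (n + 1))⁻¹ ^ Real.logb 3 2 := by
        rw [inv_three_pow_rpow_logb, pow_succ]; field_simp; norm_num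
    _ ≤ 4 * |x - y| ^ Real.logb 3 2 := by
        have := Real.rpow_le_rpow (by positivity) hlow.le logb_three_two_pos.le
        linarith

end CantorFunction

section CantorProd

open scoped Pointwise

variable {d : ℕ}

theorem abs_sub_le_dist (x y : EuclideanSpace ℝ (Fin d)) (k : Fin d) : |x k - y k| ≤ dist x y := by
  rw [dist_eq_norm, ← PiLp.sub_apply, ← Real.norm_eq_abs]
  exact PiLp.norm_apply_le (x - y) k

theorem holderOnWith_cantorFunction :
    HolderOnWith 4 (NNReal.mk (Real.logb 3 2) logb_three_two_pos.le)
      (fun (x : EuclideanSpace ℝ (Fin d)) k => cantorFunction (x k)) (cantorProd d) := by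
  intro x hx y hy
  rw [edist_pi_le_iff]
  intro k
  have hdist : dist (cantorFunction (x k)) (cantorFunction (y k)) ≤
      4 * dist x y ^ Real.logb 3 2 := by
    have := Real.rpow_le_rpow (abs_nonneg _) (abs_sub_le_dist x y k) logb_three_two_pos.le
    linarith [abs_cantorFunction_sub_le (hx k) (hy k), Real.dist_eq (cantorFunction (x k))
      (cantorFunction (y k))]
  rw [edist_dist, edist_dist x y, ENNReal.ofReal_rpow_of_nonneg dist_nonneg (NNReal.coe_nonneg _)]
  refine (ENNReal.ofReal_le_ofReal hdist).trans_eq ?_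
  rw [ENNReal.ofReal_mul (by norm_num), NNReal.coe_mk, ENNReal.ofReal_ofNat, ENNReal.coe_ofNat]

theorem pi_Ico_subset_image_cantorFunction :
    Set.pi Set.univ (fun _ : Fin d => Set.Ico (0 : ℝ) 1) ⊆
      (fun (x : EuclideanSpace ℝ (Fin d)) k => cantorFunction (x k)) '' cantorProd d := by
  intro y hy
  choose f hf using fun k => exists_cantorFunction_eq (hy k (Set.mem_univ k))
  exact ⟨WithLp.toLp 2 f, fun k => (hf k).1, funext fun k => (hf k).2⟩

theorem hausdorffMeasure_cantorProd_ne_zero : μH[d * Real.logb 3 2] (cantorProd d) ≠ 0 := by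
  intro h0
  have hmeas := (holderOnWith_cantorFunction (d := d)).hausdorffMeasure_image_le
    logb_three_two_pos (d := d) d.cast_nonneg
  rw [NNReal.coe_mk, mul_comm (Real.logb 3 2), h0, mul_zero] at hmeas
  have hvol := (measure_mono pi_Ico_subset_image_cantorFunction).trans hmeas
  have hpi : (μH[(d : ℝ)] : Measure (Fin d → ℝ)) = volume := by
    simpa only [Fintype.card_fin] using hausdorffMeasure_pi_real (ι := Fin d)
  rw [hpi, Real.volume_pi_Ico] at hvol
  simp at hvol

/-- The left endpoints, in units of `3⁻ⁿ`, of the basic intervals of level `n` of the Cantor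
set. -/
def cantorPositions : ℕ → Finset ℕ
  | 0 => {0}
  | n + 1 => (cantorPositions n).image (3 * ·) ∪ (cantorPositions n).image (3 * · + 2)

theorem card_cantorPositions_le (n : ℕ) : (cantorPositions n).card ≤ 2 ^ n := by
  induction n with
  | zero => simp only [cantorPositions, Finset.card_singleton, pow_zero, le_refl]
  | succ n ih =>
    have h0 := Finset.card_image_le (s := cantorPositions n) (f := (3 * ·))
    have h2 := Finset.card_image_le (s := cantorPositions n) (f := (3 * · + 2))
    refine (Finset.card_union_le _ _).trans ?_
    omega

theorem mem_cantorSet_iff_exists_position (n : ℕ) (x : ℝ) :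
    x ∈ cantorSet ↔ ∃ p ∈ cantorPositions n, 3 ^ n * x - (p : ℕ) ∈ cantorSet := by
  induction n with
  | zero => simp [cantorPositions]
  | succ n ih =>
    have hleft (p : ℕ) : 3 ^ (n + 1) * x - (3 * p : ℕ) = 3 * (3 ^ n * x - p) := by
      push_cast; ring
    have hright (p : ℕ) : 3 ^ (n + 1) * x - (3 * p + 2 : ℕ) = 3 * (3 ^ n * x - p) - 2 := by
      push_cast; ring
    simp only [ih, mem_cantorSet_iff (x := 3 ^ n * x - _), cantorPositions, Finset.mem_union,
      Finset.mem_image, or_and_right, exists_or, exists_exists_and_eq_and, and_or_left, hleft,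
      hright]

/-- The copy of the Cantor dust, scaled by `3⁻ⁿ`, in the triadic cube of side `3⁻ⁿ` with position
`p`, in units of `3⁻ⁿ`. -/
def cantorCell (n : ℕ) (p : Fin d → ℕ) : Set (EuclideanSpace ℝ (Fin d)) :=
  {x | ∀ k, 3 ^ n * x k - p k ∈ cantorSet}

theorem mem_cantorProd_iff_exists_cell (n : ℕ) (x : EuclideanSpace ℝ (Fin d)) :
    x ∈ cantorProd d ↔
      ∃ p ∈ Fintype.piFinset fun _ : Fin d => cantorPositions n, x ∈ cantorCell n p := by
  constructor
  · intro hx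
    choose p hp hx using fun k => (mem_cantorSet_iff_exists_position n (x k)).1 (hx k)
    exact ⟨p, Fintype.mem_piFinset.2 hp, hx⟩
  · rintro ⟨p, hp, hx⟩ k
    exact (mem_cantorSet_iff_exists_position n (x k)).2 ⟨p k, Fintype.mem_piFinset.1 hp k, hx k⟩

theorem three_rpow_mul_logb (d : ℕ) : (3 : ℝ≥0∞) ^ (d * Real.logb 3 2) = 2 ^ d := by
  have h : (3 : ℝ≥0∞) ^ Real.logb 3 2 = 2 := by
    have := congrArg ENNReal.ofReal
      (Real.rpow_logb (b := 3) (x := 2) (by norm_num) (by norm_num) (by norm_num))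
    rwa [← ENNReal.ofReal_rpow_of_pos (by norm_num), ENNReal.ofReal_ofNat,
      ENNReal.ofReal_ofNat] at this
  rw [mul_comm, ENNReal.rpow_mul, h, ENNReal.rpow_natCast]

theorem inv_three_pow_rpow_mul_logb (d n : ℕ) :
    ((3 : ℝ≥0∞) ^ n)⁻¹ ^ (d * Real.logb 3 2) = ((2 ^ d : ℝ≥0∞) ^ n)⁻¹ := by
  rw [ENNReal.inv_rpow, ← ENNReal.rpow_natCast, ← ENNReal.rpow_mul, mul_comm, ENNReal.rpow_mul,
    three_rpow_mul_logb, ENNReal.rpow_natCast]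

theorem nnnorm_inv_three_pow (n : ℕ) : (‖((3 : ℝ) ^ n)⁻¹‖₊ : ℝ≥0∞) = (3 ^ n)⁻¹ := by
  rw [nnnorm_inv, nnnorm_pow, ENNReal.coe_inv (pow_ne_zero _ (nnnorm_ne_zero_iff.2 (by norm_num)))]
  simp

theorem hausdorffMeasure_inv_three_pow_smul (n : ℕ) (v : EuclideanSpace ℝ (Fin d))
    (B : Set (EuclideanSpace ℝ (Fin d))) :
    μH[d * Real.logb 3 2] (((3 : ℝ) ^ n)⁻¹ • (IsometryEquiv.addRight v '' B)) =
      ((2 ^ d : ℝ≥0∞) ^ n)⁻¹ * μH[d * Real.logb 3 2] B := by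
  have hdim : 0 ≤ d * Real.logb 3 2 := mul_nonneg d.cast_nonneg logb_three_two_pos.le
  rw [Measure.hausdorffMeasure_smul₀ hdim (by positivity), IsometryEquiv.hausdorffMeasure_image,
    ENNReal.smul_def, smul_eq_mul, ENNReal.coe_rpow_of_nonneg _ hdim, nnnorm_inv_three_pow,
    inv_three_pow_rpow_mul_logb]

theorem ediam_inv_three_pow_smul (n : ℕ) (v : EuclideanSpace ℝ (Fin d))
    (B : Set (EuclideanSpace ℝ (Fin d))) :
    Metric.ediam (((3 : ℝ) ^ n)⁻¹ • (IsometryEquiv.addRight v '' B)) =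
      ((3 : ℝ≥0∞) ^ n)⁻¹ * Metric.ediam B := by
  rw [ediam_smul₀, IsometryEquiv.ediam_image, ENNReal.smul_def, smul_eq_mul, nnnorm_inv_three_pow]

theorem cantorCell_eq_smul_image (n : ℕ) (p : Fin d → ℕ) :
    cantorCell n p = ((3 : ℝ) ^ n)⁻¹ •
      (IsometryEquiv.addRight (WithLp.toLp 2 fun k => (p k : ℝ)) '' cantorProd d) := by
  ext x
  rw [Set.mem_inv_smul_set_iff₀ (by positivity), ← IsometryEquiv.preimage_symm]
  simp [cantorCell, cantorProd, sub_eq_add_neg]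

theorem isClosed_cantorProd (d : ℕ) : IsClosed (cantorProd d) := by
  rw [cantorProd, Set.ofPred_forall]
  exact isClosed_iInter fun k => isClosed_cantorSet.preimage (by fun_prop)

theorem cantorProd_subset_unitCube (d : ℕ) : cantorProd d ⊆ unitCube d :=
  fun _ hx k => cantorSet_subset_unitInterval (hx k)

theorem dist_le_sqrt_of_mem_unitCube {x y : EuclideanSpace ℝ (Fin d)} (hx : x ∈ unitCube d)
    (hy : y ∈ unitCube d) : dist x y ≤ √d := by
  rw [EuclideanSpace.dist_eq]
  refine Real.sqrt_le_sqrt ?_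
  calc ∑ k, dist (x k) (y k) ^ 2 ≤ ∑ _k : Fin d, (1 : ℝ) :=
        Finset.sum_le_sum fun k _ =>
          pow_le_one₀ dist_nonneg ((Real.dist_le_of_mem_Icc (hx k) (hy k)).trans_eq (sub_zero 1))
    _ = d := by simp

theorem ediam_unitCube_le (d : ℕ) : Metric.ediam (unitCube d) ≤ ENNReal.ofReal √d :=
  Metric.ediam_le fun x hx y hy => by
    rw [edist_dist]
    exact ENNReal.ofReal_le_ofReal (dist_le_sqrt_of_mem_unitCube hx hy)

theorem sqrt_le_ediam_cantorProd (d : ℕ) : ENNReal.ofReal √d ≤ Metric.ediam (cantorProd d) := by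
  have hdist : edist (0 : EuclideanSpace ℝ (Fin d)) (WithLp.toLp 2 fun _ => 1) =
      ENNReal.ofReal √d := by
    rw [edist_dist, EuclideanSpace.dist_eq]
    simp
  rw [← hdist]
  exact Metric.edist_le_ediam_of_mem (fun _ => zero_mem_cantorSet) fun _ => one_mem_cantorSet

theorem ediam_cantorProd (d : ℕ) : Metric.ediam (cantorProd d) = ENNReal.ofReal √d :=
  ((Metric.ediam_mono (cantorProd_subset_unitCube d)).trans (ediam_unitCube_le d)).antisymm
    (sqrt_le_ediam_cantorProd d)

theorem ediam_unitCube (d : ℕ) : Metric.ediam (unitCube d) = ENNReal.ofReal √d :=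
  (ediam_unitCube_le d).antisymm
    ((sqrt_le_ediam_cantorProd d).trans (Metric.ediam_mono (cantorProd_subset_unitCube d)))

end CantorProd

section CantorMeasure

variable {d : ℕ}

theorem sum_ediam_cantorCell_rpow_le (n : ℕ) :
    ∑ p : {p // p ∈ Fintype.piFinset fun _ : Fin d => cantorPositions n},
      Metric.ediam (cantorCell n p.1) ^ (d * Real.logb 3 2) ≤
        Metric.ediam (cantorProd d) ^ (d * Real.logb 3 2) := by
  have hcard : ((cantorPositions n).card : ℝ≥0∞) ^ d ≤ (2 ^ d) ^ n := by
    rw [← pow_mul, mul_comm d, pow_mul]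
    exact_mod_cast Nat.pow_le_pow_left (card_cantorPositions_le n) d
  simp only [cantorCell_eq_smul_image, ediam_inv_three_pow_smul,
    ENNReal.mul_rpow_of_nonneg _ _ (mul_nonneg d.cast_nonneg logb_three_two_pos.le),
    inv_three_pow_rpow_mul_logb, Finset.sum_const, Finset.card_univ, Fintype.card_coe,
    nsmul_eq_mul, Fintype.card_piFinset_const, Nat.cast_pow]
  rw [← mul_assoc, ← div_eq_mul_inv]
  exact mul_le_of_le_one_left' (ENNReal.div_le_of_le_mul (hcard.trans_eq (one_mul _).symm))

theorem hausdorffMeasure_cantorProd_ne_top : μH[d * Real.logb 3 2] (cantorProd d) ≠ ∞ := by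
  have hdiam : Metric.ediam (cantorProd d) ≠ ∞ := by
    rw [ediam_cantorProd]; exact ENNReal.ofReal_ne_top
  have hlim : Filter.Tendsto (fun n : ℕ => ((3 : ℝ≥0∞) ^ n)⁻¹ * Metric.ediam (cantorProd d))
      Filter.atTop (nhds 0) := by
    have h := ENNReal.tendsto_pow_atTop_nhds_zero_of_lt_one (r := (3 : ℝ≥0∞)⁻¹) (by simp)
    simpa only [ENNReal.inv_pow, zero_mul] using ENNReal.Tendsto.mul_const h (.inr hdiam)
  have hle := Measure.hausdorffMeasure_le_liminf_sum
    (ι := fun n => {p // p ∈ Fintype.piFinset fun _ : Fin d => cantorPositions n})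
    (d * Real.logb 3 2) (cantorProd d) _ hlim (fun n p => cantorCell n p.1)
    (.of_forall fun n p => by rw [cantorCell_eq_smul_image, ediam_inv_three_pow_smul])
    (.of_forall fun n x hx => by
      obtain ⟨p, hp, hx⟩ := (mem_cantorProd_iff_exists_cell n x).1 hx
      exact Set.mem_iUnion.2 ⟨⟨p, hp⟩, hx⟩)
  refine (hle.trans_lt (lt_of_le_of_lt ?_ (ENNReal.rpow_lt_top_of_nonneg
    (mul_nonneg d.cast_nonneg logb_three_two_pos.le) hdiam))).ne
  refine Filter.liminf_le_of_le (by isBoundedDefault) fun b hb => ?_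
  obtain ⟨n, hn⟩ := hb.exists
  exact hn.trans (sum_ediam_cantorCell_rpow_le n)

theorem cantorDim_eq (d : ℕ) : cantorDim d = d * Real.logb 3 2 := by
  have hdim := dimH_of_hausdorffMeasure_ne_zero_ne_top
    (d := NNReal.mk (d * Real.logb 3 2) (mul_nonneg d.cast_nonneg logb_three_two_pos.le))
    hausdorffMeasure_cantorProd_ne_zero hausdorffMeasure_cantorProd_ne_top
  rw [cantorDim, hdim, ENNReal.coe_toReal, NNReal.coe_mk]

theorem cantorDim_nonneg (d : ℕ) : 0 ≤ cantorDim d := ENNReal.toReal_nonneg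

theorem cantorDim_pos (d : ℕ) [NeZero d] : 0 < cantorDim d := by
  rw [cantorDim_eq]
  exact mul_pos (Nat.cast_pos.2 (NeZero.pos d)) logb_three_two_pos

theorem three_rpow_cantorDim (d : ℕ) : (3 : ℝ≥0∞) ^ cantorDim d = 2 ^ d := by
  rw [cantorDim_eq, three_rpow_mul_logb]

/-- `cantorMeasure`, restricted to measurable sets and so made a `Measure`. -/
noncomputable def cantorProb (d : ℕ) : Measure (EuclideanSpace ℝ (Fin d)) :=
  (μH[cantorDim d] (cantorProd d))⁻¹ • (μH[cantorDim d]).restrict (cantorProd d)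

theorem cantorMeasure_eq (A : Set (EuclideanSpace ℝ (Fin d))) :
    cantorMeasure d A = cantorProb d A := by
  rw [cantorMeasure, cantorProb, Measure.smul_apply,
    Measure.restrict_apply' (isClosed_cantorProd d).measurableSet, smul_eq_mul, div_eq_mul_inv,
    mul_comm]

instance : IsProbabilityMeasure (cantorProb d) := by
  constructor
  rw [← cantorMeasure_eq, cantorMeasure, Set.univ_inter, cantorDim_eq]
  exact ENNReal.div_self hausdorffMeasure_cantorProd_ne_zero hausdorffMeasure_cantorProd_ne_top

theorem cantorProb_inter (A : Set (EuclideanSpace ℝ (Fin d))) :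
    cantorProb d (A ∩ cantorProd d) = cantorProb d A := by
  rw [← cantorMeasure_eq, ← cantorMeasure_eq, cantorMeasure, cantorMeasure, Set.inter_assoc,
    Set.inter_self]

theorem cantorProb_cantorCell_le (n : ℕ) (p : Fin d → ℕ) :
    cantorProb d (cantorCell n p) ≤ ((2 ^ d : ℝ≥0∞) ^ n)⁻¹ := by
  rw [← cantorMeasure_eq, cantorMeasure, cantorDim_eq]
  refine ENNReal.div_le_of_le_mul ?_
  rw [← hausdorffMeasure_inv_three_pow_smul, ← cantorCell_eq_smul_image]
  exact measure_mono Set.inter_subset_left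

theorem cantorProb_le_card_mul {ι : Type*} (n : ℕ) (P : Finset ι) (pos : ι → Fin d → ℕ)
    {A : Set (EuclideanSpace ℝ (Fin d))}
    (h : ∀ x ∈ A ∩ cantorProd d, ∃ i ∈ P, x ∈ cantorCell n (pos i)) :
    cantorProb d A ≤ P.card * ((2 ^ d : ℝ≥0∞) ^ n)⁻¹ := by
  rw [← cantorProb_inter]
  have hsub : A ∩ cantorProd d ⊆ ⋃ i ∈ P, cantorCell n (pos i) := fun x hx => by
    obtain ⟨i, hi, hxi⟩ := h x hx
    exact Set.mem_biUnion hi hxi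
  calc cantorProb d (A ∩ cantorProd d)
      ≤ ∑ i ∈ P, cantorProb d (cantorCell n (pos i)) :=
        (measure_mono hsub).trans (measure_biUnion_finset_le _ _)
    _ ≤ P.card • ((2 ^ d : ℝ≥0∞) ^ n)⁻¹ :=
        Finset.sum_le_card_nsmul _ _ _ fun i _ => cantorProb_cantorCell_le n (pos i)
    _ = P.card * ((2 ^ d : ℝ≥0∞) ^ n)⁻¹ := nsmul_eq_mul _ _

theorem diamRatio_eq (A : Set (EuclideanSpace ℝ (Fin d))) :
    diamRatio d A = Metric.ediam A ^ cantorDim d / cantorProb d A := by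
  rw [diamRatio, cantorMeasure_eq]

end CantorMeasure

section BasicCubes

open scoped Pointwise

variable {d : ℕ} {A B : Set (EuclideanSpace ℝ (Fin d))} {i j : Fin d → Fin 2}
  {x y : EuclideanSpace ℝ (Fin d)}

theorem cantorMap_apply (i : Fin d → Fin 2) (x : EuclideanSpace ℝ (Fin d)) (k : Fin d) :
    cantorMap d i x k = x k / 3 + 2 / 3 * ((i k : ℕ) : ℝ) := by
  simp only [cantorMap, PiLp.add_apply, PiLp.smul_apply, smul_eq_mul]
  ring

theorem cantorMap_image_eq_smul (i : Fin d → Fin 2) (B : Set (EuclideanSpace ℝ (Fin d))) :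
    cantorMap d i '' B = ((3 : ℝ) ^ 1)⁻¹ •
      (IsometryEquiv.addRight (WithLp.toLp 2 fun k => 2 * ((i k : ℕ) : ℝ)) '' B) := by
  rw [← Set.image_smul, Set.image_image]
  refine Set.image_congr fun x _ => ?_
  ext k
  simp only [cantorMap_apply, IsometryEquiv.addRight_apply, PiLp.smul_apply, PiLp.add_apply,
    smul_eq_mul]
  ring

theorem cantorMap_surjective (i : Fin d → Fin 2) : Function.Surjective (cantorMap d i) := by
  refine fun x => ⟨WithLp.toLp 2 fun k => 3 * x k - 2 * ((i k : ℕ) : ℝ), ?_⟩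
  ext k
  rw [cantorMap_apply]
  ring

theorem ediam_cantorMap_preimage (i : Fin d → Fin 2) (A : Set (EuclideanSpace ℝ (Fin d))) :
    Metric.ediam (cantorMap d i ⁻¹' A) = 3 * Metric.ediam A := by
  conv_rhs => rw [← Set.image_preimage_eq A (cantorMap_surjective i), cantorMap_image_eq_smul,
    ediam_inv_three_pow_smul, pow_one, ← mul_assoc,
    ENNReal.mul_inv_cancel (by norm_num) (by norm_num), one_mul]

theorem mem_basicCube_iff : x ∈ basicCube d i ↔
    ∀ k, x k ∈ Set.Icc (2 / 3 * ((i k : ℕ) : ℝ)) (2 / 3 * ((i k : ℕ) : ℝ) + 1 / 3) := by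
  simp only [Set.mem_Icc]
  constructor
  · rintro ⟨y, hy, rfl⟩ k
    obtain ⟨h0, h1⟩ := hy k
    rw [cantorMap_apply]
    constructor <;> linarith
  · intro h
    obtain ⟨y, rfl⟩ := cantorMap_surjective i x
    simp only [cantorMap_apply] at h
    exact ⟨y, fun k => ⟨by linarith [(h k).1], by linarith [(h k).2]⟩, rfl⟩

theorem cantorMap_mem_cantorProd (i : Fin d → Fin 2) (hx : x ∈ cantorProd d) :
    cantorMap d i x ∈ cantorProd d := by
  intro k
  rw [cantorMap_apply, mem_cantorSet_iff]
  rcases Fin.exists_fin_two.1 ⟨i k, rfl⟩ with h | h <;> rw [h]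
  · exact .inl (by convert hx k using 1; simp; ring)
  · exact .inr (by convert hx k using 1; simp; ring)

theorem mem_cantorProd_of_cantorMap_mem (hx : x ∈ unitCube d)
    (h : cantorMap d i x ∈ cantorProd d) : x ∈ cantorProd d := by
  intro k
  obtain ⟨h0, h1⟩ := hx k
  have hk := h k
  rw [cantorMap_apply, mem_cantorSet_iff] at hk
  rcases Fin.exists_fin_two.1 ⟨i k, rfl⟩ with hik | hik <;>
    simp only [hik, Fin.val_zero, Fin.val_one, Nat.cast_zero, Nat.cast_one] at hk <;>
    rcases hk with hk | hk <;> obtain ⟨hk0, hk1⟩ := cantorSet_subset_unitInterval hk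
  · convert hk using 1; ring
  · linarith
  · rw [show x k = 0 by linarith]
    exact zero_mem_cantorSet
  · convert hk using 1; ring

theorem cantorProd_inter_basicCube (i : Fin d → Fin 2) :
    cantorProd d ∩ basicCube d i = cantorMap d i '' cantorProd d := by
  refine Set.Subset.antisymm ?_ ?_
  · rintro _ ⟨hE, x, hx, rfl⟩
    exact ⟨x, mem_cantorProd_of_cantorMap_mem hx hE, rfl⟩
  · rintro _ ⟨x, hx, rfl⟩
    exact ⟨cantorMap_mem_cantorProd i hx, x, cantorProd_subset_unitCube d hx, rfl⟩

theorem cantorProb_cantorMap_preimage (h : A ∩ cantorProd d ⊆ basicCube d i) :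
    cantorProb d (cantorMap d i ⁻¹' A) = 2 ^ d * cantorProb d A := by
  have himage : A ∩ cantorProd d = cantorMap d i '' (cantorMap d i ⁻¹' A ∩ cantorProd d) := by
    rw [Set.image_preimage_inter, ← cantorProd_inter_basicCube, ← Set.inter_assoc]
    exact (Set.inter_eq_left.2 h).symm
  rw [← cantorMeasure_eq, ← cantorMeasure_eq, cantorMeasure, cantorMeasure, cantorDim_eq, himage,
    cantorMap_image_eq_smul, hausdorffMeasure_inv_three_pow_smul, pow_one, mul_div_assoc,
    ← mul_assoc, ENNReal.mul_inv_cancel (by positivity) (by simp), one_mul]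

theorem diamRatio_cantorMap_preimage (h : A ∩ cantorProd d ⊆ basicCube d i) :
    diamRatio d (cantorMap d i ⁻¹' A) = diamRatio d A := by
  rw [diamRatio_eq, diamRatio_eq, ediam_cantorMap_preimage, cantorProb_cantorMap_preimage h,
    ENNReal.mul_rpow_of_nonneg _ _ (cantorDim_nonneg d), three_rpow_cantorDim,
    ENNReal.mul_div_mul_left _ _ (by positivity) (by simp)]

theorem third_le_dist_of_mem_basicCube (hij : i ≠ j) (hx : x ∈ basicCube d i)
    (hy : y ∈ basicCube d j) : 1 / 3 ≤ dist x y := by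
  obtain ⟨k, hk⟩ := Function.ne_iff.1 hij
  refine le_trans ?_ (abs_sub_le_dist x y k)
  obtain ⟨hx0, hx1⟩ := mem_basicCube_iff.1 hx k
  obtain ⟨hy0, hy1⟩ := mem_basicCube_iff.1 hy k
  rw [le_abs]
  rcases (show (i k = 0 ∧ j k = 1) ∨ (i k = 1 ∧ j k = 0) by omega) with ⟨hi, hj⟩ | ⟨hi, hj⟩ <;>
    simp only [hi, hj, Fin.val_zero, Fin.val_one, Nat.cast_zero, Nat.cast_one] at hx0 hx1 hy0 hy1
  · exact .inr (by linarith)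
  · exact .inl (by linarith)

theorem eq_of_mem_basicCube (hi : x ∈ basicCube d i) (hj : x ∈ basicCube d j) : i = j := by
  by_contra hij
  have := third_le_dist_of_mem_basicCube hij hi hj
  norm_num at this

theorem exists_mem_basicCube (hx : x ∈ cantorProd d) : ∃ i, x ∈ basicCube d i := by
  have hk : ∀ k, ∃ c : Fin 2,
      x k ∈ Set.Icc (2 / 3 * ((c : ℕ) : ℝ)) (2 / 3 * ((c : ℕ) : ℝ) + 1 / 3) := fun k => by
    rcases mem_Icc_thirds_of_mem_cantorSet (hx k) with h | h
    · exact ⟨0, by simpa using h⟩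
    · exact ⟨1, by norm_num; simpa using h⟩
  choose i hi using hk
  exact ⟨i, mem_basicCube_iff.2 hi⟩

theorem cantorGap_eq (d : ℕ) [NeZero d] : cantorGap d = 1 / 3 := by
  have hzero : (0 : EuclideanSpace ℝ (Fin d)) ∈ cantorProd d := fun _ => zero_mem_cantorSet
  have hne : (0 : Fin d → Fin 2) ≠ Pi.single 0 1 := fun h => by simpa using congrFun h 0
  refine le_antisymm ?_ ?_
  · have hone : EuclideanSpace.single 0 1 ∈ cantorProd d := fun k => by
      rcases eq_or_ne k 0 with rfl | hk
      · simpa using one_mem_cantorSet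
      · simpa [hk] using zero_mem_cantorSet
    refine (ciInf_le (Set.finite_range _).bddBelow ⟨(0, Pi.single 0 1), hne⟩).trans
      (csInf_le ⟨0, ?_⟩ ⟨_, Set.mem_image_of_mem _ hone, _, Set.mem_image_of_mem _ hzero, ?_⟩)
    · rintro _ ⟨x, -, y, -, rfl⟩
      exact dist_nonneg
    · have hsub : cantorMap d 0 (EuclideanSpace.single 0 1) - cantorMap d (Pi.single 0 1) 0 =
          EuclideanSpace.single 0 (-1 / 3) := by
        ext k
        rcases eq_or_ne k 0 with rfl | hk
        · rw [PiLp.sub_apply, cantorMap_apply, cantorMap_apply]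
          norm_num
        · rw [PiLp.sub_apply, cantorMap_apply, cantorMap_apply]
          simp [hk]
      rw [dist_eq_norm, hsub, PiLp.norm_single]
      norm_num
  · have : Nonempty {p : (Fin d → Fin 2) × (Fin d → Fin 2) // p.1 ≠ p.2} := ⟨⟨(0, _), hne⟩⟩
    refine le_ciInf fun p => le_csInf ?_ ?_
    · exact ⟨_, _, Set.mem_image_of_mem _ hzero, _, Set.mem_image_of_mem _ hzero, rfl⟩
    · rintro _ ⟨x, hx, y, hy, rfl⟩
      rw [← cantorProd_inter_basicCube] at hx hy
      exact third_le_dist_of_mem_basicCube p.2 hx.2 hy.2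

theorem numBasicMet_mono (h : A ⊆ B) : numBasicMet d A ≤ numBasicMet d B :=
  Set.ncard_le_ncard (fun _ hi => hi.mono (Set.inter_subset_inter_left _ h)) (Set.toFinite _)

end BasicCubes

section Existence

open Filter Topology

section UltraLimit

variable {X : Type*} [PseudoEMetricSpace X] {𝒰 : Ultrafilter ℕ} {A : ℕ → Set X} {S : Set X}

/-- The limits along the ultrafilter `𝒰` of sequences of points of the sets `A n`. For subsets of
a compact set this plays the role of a limit in the Hausdorff distance. -/
def ultraLimit (𝒰 : Ultrafilter ℕ) (A : ℕ → Set X) : Set X :=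
  {x | ∃ a : ℕ → X, (∀ n, a n ∈ A n) ∧ Tendsto a 𝒰 (𝓝 x)}

theorem exists_mem_ultraLimit_tendsto (hS : IsCompact S) (hAS : ∀ n, A n ⊆ S) {a : ℕ → X}
    (ha : ∀ n, a n ∈ A n) : ∃ x ∈ ultraLimit 𝒰 A, Tendsto a 𝒰 (𝓝 x) := by
  obtain ⟨x, -, hx⟩ := hS.ultrafilter_le_nhds (𝒰.map a)
    (le_principal_iff.2 (mem_map.2 (univ_mem' fun n => hAS n (ha n))))
  exact ⟨x, ⟨a, ha, hx⟩, hx⟩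

theorem ediam_ultraLimit_le {δ : ℝ≥0∞} (hδ : Tendsto (fun n => Metric.ediam (A n)) 𝒰 (𝓝 δ)) :
    Metric.ediam (ultraLimit 𝒰 A) ≤ δ := by
  refine Metric.ediam_le ?_
  rintro x ⟨a, ha, hax⟩ y ⟨b, hb, hby⟩
  exact le_of_tendsto_of_tendsto (hax.edist hby) hδ
    (.of_forall fun n => Metric.edist_le_ediam_of_mem (ha n) (hb n))

theorem le_ediam_ultraLimit (hS : IsCompact S) (hAS : ∀ n, A n ⊆ S) (hne : ∀ n, (A n).Nonempty)
    {δ : ℝ≥0∞} (hδ : Tendsto (fun n => Metric.ediam (A n)) 𝒰 (𝓝 δ)) :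
    δ ≤ Metric.ediam (ultraLimit 𝒰 A) := by
  refine le_of_forall_lt fun r hr => ?_
  obtain ⟨q, hrq, hqδ⟩ := exists_between hr
  have hfar : ∀ n, ∃ x ∈ A n, ∃ y ∈ A n, q < Metric.ediam (A n) → q < edist x y := fun n => by
    by_contra! hclose
    obtain ⟨x, hx⟩ := hne n
    exact (hclose x hx x hx).1.not_ge (Metric.ediam_le fun x hx y hy => (hclose x hx y hy).2)
  choose a ha b hb hab using hfar
  obtain ⟨x, hx, hax⟩ := exists_mem_ultraLimit_tendsto (𝒰 := 𝒰) hS hAS ha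
  obtain ⟨y, hy, hby⟩ := exists_mem_ultraLimit_tendsto (𝒰 := 𝒰) hS hAS hb
  have hq : q ≤ edist x y := ge_of_tendsto (hax.edist hby)
    ((hδ.eventually (lt_mem_nhds hqδ)).mono fun n hn => (hab n hn).le)
  exact hrq.trans_le (hq.trans (Metric.edist_le_ediam_of_mem hx hy))

theorem eventually_subset_thickening_ultraLimit (hS : IsCompact S) (hAS : ∀ n, A n ⊆ S)
    (hne : ∀ n, (A n).Nonempty) {ε : ℝ} (hε : 0 < ε) :
    ∀ᶠ n in 𝒰, A n ⊆ Metric.thickening ε (ultraLimit 𝒰 A) := by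
  have hout : ∀ n, ∃ a ∈ A n, a ∈ Metric.thickening ε (ultraLimit 𝒰 A) →
      A n ⊆ Metric.thickening ε (ultraLimit 𝒰 A) := fun n => by
    by_contra! h
    obtain ⟨x, hx⟩ := hne n
    exact (h x hx).2 fun y hy => (h y hy).1
  choose a ha hsub using hout
  obtain ⟨x, hx, hax⟩ := exists_mem_ultraLimit_tendsto (𝒰 := 𝒰) hS hAS ha
  exact (hax.eventually (Metric.isOpen_thickening.mem_nhds
    (Metric.self_subset_thickening hε _ hx))).mono hsub

theorem le_measure_closure_ultraLimit [MeasurableSpace X] [OpensMeasurableSpace X] (μ : Measure X)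
    [IsFiniteMeasure μ] (hS : IsCompact S) (hAS : ∀ n, A n ⊆ S) (hne : ∀ n, (A n).Nonempty)
    {m : ℝ≥0∞} (hm : Tendsto (fun n => μ (A n)) 𝒰 (𝓝 m)) : m ≤ μ (closure (ultraLimit 𝒰 A)) := by
  have hlim := tendsto_measure_cthickening (μ := μ) (s := ultraLimit 𝒰 A)
    ⟨1, one_pos, measure_ne_top _ _⟩
  refine ge_of_tendsto (hlim.mono_left (nhdsWithin_le_nhds (s := Set.Ioi 0))) ?_
  filter_upwards [self_mem_nhdsWithin] with ε hε
  exact le_of_tendsto hm ((eventually_subset_thickening_ultraLimit hS hAS hne hε).mono fun n hn =>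
    measure_mono (hn.trans (Metric.thickening_subset_cthickening _ _)))

end UltraLimit

theorem convex_ultraLimit {E : Type*} [NormedAddCommGroup E] [NormedSpace ℝ E]
    {𝒰 : Ultrafilter ℕ} {A : ℕ → Set E} (hA : ∀ n, Convex ℝ (A n)) :
    Convex ℝ (ultraLimit 𝒰 A) := by
  rintro x ⟨a, ha, hax⟩ y ⟨b, hb, hby⟩ s t hs ht hst
  exact ⟨fun n => s • a n + t • b n, fun n => hA n (ha n) (hb n) hs ht hst,
    (hax.const_smul s).add (hby.const_smul t)⟩

variable {d : ℕ}

theorem ediam_ne_top_of_mem_admissibleSets {A : Set (EuclideanSpace ℝ (Fin d))}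
    (hA : A ∈ admissibleSets d) : Metric.ediam A ≠ ∞ :=
  ne_top_of_le_ne_top (ediam_cantorProd d ▸ ENNReal.ofReal_ne_top) hA.2.2

theorem subset_closedBall_of_mem_admissibleSets {A : Set (EuclideanSpace ℝ (Fin d))}
    (hA : A ∈ admissibleSets d) (h : (A ∩ cantorProd d).Nonempty) :
    A ⊆ Metric.closedBall 0 (√d + √d) := by
  obtain ⟨y, hyA, hyE⟩ := h
  intro x hx
  have hxy : dist x y ≤ √d := by
    have hle := (Metric.edist_le_ediam_of_mem hx hyA).trans hA.2.2
    rwa [ediam_cantorProd, edist_dist, ENNReal.ofReal_le_ofReal_iff (Real.sqrt_nonneg _)] at hle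
  have hy0 : dist y 0 ≤ √d := dist_le_sqrt_of_mem_unitCube (cantorProd_subset_unitCube d hyE)
    fun _ => ⟨le_rfl, zero_le_one⟩
  exact (dist_triangle x y 0).trans (add_le_add hxy hy0)

theorem convex_unitCube (d : ℕ) : Convex ℝ (unitCube d) := by
  rintro x hx y hy a b ha hb hab k
  exact convex_Icc (0 : ℝ) 1 (hx k) (hy k) ha hb hab

theorem diamRatio_unitCube_ne_top : diamRatio d (unitCube d) ≠ ∞ := by
  have hmass : cantorProb d (unitCube d) = 1 := by
    rw [← cantorProb_inter, Set.inter_eq_right.2 (cantorProd_subset_unitCube d),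
      ← Set.univ_inter (cantorProd d), cantorProb_inter, measure_univ]
  rw [diamRatio_eq, hmass, div_one, ediam_unitCube]
  exact ENNReal.rpow_ne_top_of_nonneg (cantorDim_nonneg d) ENNReal.ofReal_ne_top

variable [NeZero d]

theorem ediam_ne_zero_of_mem_admissibleSets {A : Set (EuclideanSpace ℝ (Fin d))}
    (hA : A ∈ admissibleSets d) : Metric.ediam A ≠ 0 := by
  refine (lt_of_lt_of_le ?_ hA.2.1).ne'
  rw [cantorGap_eq, ENNReal.ofReal_pos]
  norm_num

theorem nonempty_inter_cantorProd {A : Set (EuclideanSpace ℝ (Fin d))} (hA : A ∈ admissibleSets d)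
    (h : diamRatio d A ≠ ∞) : (A ∩ cantorProd d).Nonempty := by
  by_contra! hempty
  rw [diamRatio_eq, ← cantorProb_inter, hempty, measure_empty] at h
  refine h (ENNReal.div_zero ?_)
  rw [Ne, ENNReal.rpow_eq_zero_iff_of_pos (cantorDim_pos d)]
  exact ediam_ne_zero_of_mem_admissibleSets hA

theorem exists_diamRatio_le_of_tendsto {𝒰 : Ultrafilter ℕ}
    {A : ℕ → Set (EuclideanSpace ℝ (Fin d))} (hA : ∀ n, A n ∈ admissibleSets d)
    (hfin : ∀ n, diamRatio d (A n) ≠ ∞) {r : ℝ≥0∞}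
    (hr : Tendsto (fun n => diamRatio d (A n)) 𝒰 (𝓝 r)) :
    ∃ K ∈ admissibleSets d, diamRatio d K ≤ r := by
  have hmeet := fun n => nonempty_inter_cantorProd (hA n) (hfin n)
  have hS := isCompact_closedBall (0 : EuclideanSpace ℝ (Fin d)) (√d + √d)
  have hAS := fun n => subset_closedBall_of_mem_admissibleSets (hA n) (hmeet n)
  have hne := fun n => (hmeet n).mono Set.inter_subset_left
  have hδ : Tendsto (fun n => Metric.ediam (A n)) 𝒰 (𝓝 _) := (𝒰.map _).le_nhds_lim
  have hm : Tendsto (fun n => cantorProb d (A n)) 𝒰 (𝓝 _) := (𝒰.map _).le_nhds_lim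
  set K := closure (ultraLimit 𝒰 A)
  have hdiam : Metric.ediam K = (𝒰.map fun n => Metric.ediam (A n)).lim := by
    rw [Metric.ediam_closure]
    exact (ediam_ultraLimit_le hδ).antisymm (le_ediam_ultraLimit hS hAS hne hδ)
  rw [← hdiam] at hδ
  have hK : K ∈ admissibleSets d := ⟨(convex_ultraLimit fun n => (hA n).1).closure,
    ge_of_tendsto hδ (.of_forall fun n => (hA n).2.1),
    le_of_tendsto hδ (.of_forall fun n => (hA n).2.2)⟩
  have hlim : Tendsto (fun n => diamRatio d (A n)) 𝒰
      (𝓝 (Metric.ediam K ^ cantorDim d / (𝒰.map fun n => cantorProb d (A n)).lim)) := by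
    simp only [diamRatio_eq]
    refine ENNReal.Tendsto.div (hδ.ennrpow_const _) (.inl ?_) hm (.inr ?_)
    · rw [Ne, ENNReal.rpow_eq_zero_iff_of_pos (cantorDim_pos d)]
      exact ediam_ne_zero_of_mem_admissibleSets hK
    · exact ENNReal.rpow_ne_top_of_nonneg (cantorDim_nonneg d)
        (ediam_ne_top_of_mem_admissibleSets hK)
  refine ⟨K, hK, ?_⟩
  rw [← tendsto_nhds_unique hlim hr, diamRatio_eq]
  exact ENNReal.div_le_div_left (le_measure_closure_ultraLimit _ hS hAS hne hm) _

theorem unitCube_mem_admissibleSets : unitCube d ∈ admissibleSets d := by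
  refine ⟨convex_unitCube d, ?_, by rw [ediam_unitCube, ediam_cantorProd]⟩
  rw [ediam_unitCube, cantorGap_eq]
  refine ENNReal.ofReal_le_ofReal (le_trans (by norm_num) (Real.one_le_sqrt.2 ?_))
  exact Nat.one_le_cast.2 (NeZero.pos d)

theorem exists_isOptimalSet (d : ℕ) [NeZero d] : ∃ A, IsOptimalSet d A := by
  set V := diamRatio d '' admissibleSets d
  have hcube : diamRatio d (unitCube d) ∈ V := Set.mem_image_of_mem _ unitCube_mem_admissibleSets
  have hlt : sInf V < ∞ := (sInf_le hcube).trans_lt diamRatio_unitCube_ne_top.lt_top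
  obtain ⟨u, -, hu, huV⟩ := exists_seq_tendsto_sInf ⟨_, hcube⟩ (OrderBot.bddBelow V)
  obtain ⟨N, hN⟩ := eventually_atTop.1 (hu.eventually (gt_mem_nhds hlt))
  choose A hA hAu using fun n => huV (n + N)
  have hlim : Tendsto (fun n => diamRatio d (A n)) (hyperfilter ℕ) (𝓝 (sInf V)) := by
    simp only [hAu]
    exact ((tendsto_add_atTop_iff_nat N).2 hu).mono_left Nat.hyperfilter_le_atTop
  obtain ⟨K, hK, hKV⟩ := exists_diamRatio_le_of_tendsto hA
    (fun n => hAu n ▸ (hN _ (Nat.le_add_left N n)).ne) hlim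
  exact ⟨K, hK, fun B hB => hKV.trans (sInf_le ⟨B, hB, rfl⟩)⟩

end Existence

section TestBall

theorem twenty_eight_mul_cantorDim_three_le : 28 * cantorDim 3 ≤ 53 := by
  have h : 84 * Real.logb 3 2 = Real.logb 3 (2 ^ 84) := by
    rw [Real.logb_pow]
    norm_num
  have : Real.logb 3 (2 ^ 84) ≤ 53 := by
    rw [Real.logb_le_iff_le_rpow (by norm_num) (by positivity)]
    norm_num
  rw [cantorDim_eq]
  push_cast
  linarith

theorem three_le_two_mul_cantorDim_three : 3 ≤ 2 * cantorDim 3 := by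
  have h : 6 * Real.logb 3 2 = Real.logb 3 (2 ^ 6) := by
    rw [Real.logb_pow]
    norm_num
  have : 3 ≤ Real.logb 3 (2 ^ 6) := by
    rw [Real.le_logb_iff_rpow_le (by norm_num) (by positivity)]
    norm_num
  rw [cantorDim_eq]
  push_cast
  linarith

/-- The diameter of the competing ball; it is chosen by the number of cells of level 4 which the
ball contains. -/
noncomputable def testDiam : ℝ := √14515 / 81

theorem testDiam_sq : testDiam ^ 2 = 14515 / 6561 := by
  rw [testDiam, div_pow, Real.sq_sqrt (by norm_num)]
  norm_num

theorem testDiam_pos : 0 < testDiam := by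
  unfold testDiam
  positivity

theorem one_le_testDiam : 1 ≤ testDiam :=
  (one_le_sq_iff₀ testDiam_pos.le).1 (by rw [testDiam_sq]; norm_num)

theorem dist_sq_eq_sum {d : ℕ} (x y : EuclideanSpace ℝ (Fin d)) :
    dist x y ^ 2 = ∑ k, (x k - y k) ^ 2 := by
  simp only [PiLp.dist_sq_eq_of_L2, Real.dist_eq, sq_abs]

/-- The largest distance from `1 / 2` to a point of the triadic interval of level 4 at position
`p`, in units of `1 / 162`. -/
def farEdge (p : ℕ) : ℕ := max (81 - 2 * p) (2 * p + 2 - 81)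

theorem abs_sub_half_le_farEdge {x : ℝ} {p : ℕ} (hx : 3 ^ 4 * x - (p : ℕ) ∈ cantorSet) :
    162 * |x - 1 / 2| ≤ farEdge p := by
  obtain ⟨h0, h1⟩ := cantorSet_subset_unitInterval hx
  have hleft : (81 : ℝ) ≤ farEdge p + 2 * p := mod_cast
    (by unfold farEdge; omega : 81 ≤ farEdge p + 2 * p)
  have hright : (2 : ℝ) * p + 2 ≤ farEdge p + 81 := mod_cast
    (by unfold farEdge; omega : 2 * p + 2 ≤ farEdge p + 81)
  rw [← abs_of_pos (by norm_num : (0 : ℝ) < 162), ← abs_mul, abs_le]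
  constructor <;> linarith

/-- The positions of the cells of level 4 which are not contained in the competing ball. -/
def outerCells : Finset (Fin 3 → ℕ) :=
  (Fintype.piFinset fun _ => cantorPositions 4).filter fun p => 14515 < ∑ k, farEdge (p k) ^ 2

theorem card_outerCells : outerCells.card = 472 := by
  decide +kernel

/-- The competing ball, about the centre of the unit cube. -/
noncomputable def testBall : Set (EuclideanSpace ℝ (Fin 3)) :=
  Metric.closedBall (WithLp.toLp 2 fun _ => 1 / 2) (testDiam / 2)

theorem mem_testBall_of_mem_cantorCell {x : EuclideanSpace ℝ (Fin 3)} {p : Fin 3 → ℕ}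
    (hx : x ∈ cantorCell 4 p) (hp : ∑ k, farEdge (p k) ^ 2 ≤ 14515) : x ∈ testBall := by
  have hcoord (k : Fin 3) : 162 ^ 2 * (x k - 1 / 2) ^ 2 ≤ (farEdge (p k) : ℝ) ^ 2 := by
    rw [← sq_abs (x k - 1 / 2), ← mul_pow]
    exact pow_le_pow_left₀ (by positivity) (abs_sub_half_le_farEdge (hx k)) 2
  have hsum := Finset.sum_le_sum fun k (_ : k ∈ Finset.univ) => hcoord k
  rw [← Finset.mul_sum] at hsum
  have hp' : ∑ k, (farEdge (p k) : ℝ) ^ 2 ≤ 14515 := mod_cast hp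
  refine Metric.mem_closedBall.2 ((sq_le_sq₀ dist_nonneg (half_pos testDiam_pos).le).1 ?_)
  rw [div_pow, testDiam_sq, dist_sq_eq_sum]
  linarith

theorem cantorProb_compl_testBall_le : cantorProb 3 testBallᶜ ≤ 472 * ((2 ^ 3) ^ 4)⁻¹ := by
  refine (cantorProb_le_card_mul 4 outerCells id fun x ⟨hx, hxE⟩ => ?_).trans_eq
    (by rw [card_outerCells, Nat.cast_ofNat])
  obtain ⟨p, hp, hxp⟩ := (mem_cantorProd_iff_exists_cell 4 x).1 hxE
  exact ⟨p, Finset.mem_filter.2 ⟨hp, not_le.1 fun h => hx (mem_testBall_of_mem_cantorCell hxp h)⟩,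
    hxp⟩

theorem le_cantorProb_testBall : ENNReal.ofReal (453 / 512) ≤ cantorProb 3 testBall := by
  have hcompl : (cantorProb 3).real testBallᶜ ≤ 472 / 4096 := by
    refine (ENNReal.toReal_mono (ENNReal.mul_ne_top (by norm_num) (by simp))
      cantorProb_compl_testBall_le).trans_eq ?_
    rw [ENNReal.toReal_mul, ENNReal.toReal_inv]
    norm_num
  rw [testBall, probReal_compl_eq_one_sub Metric.isClosed_closedBall.measurableSet,
    ← testBall] at hcompl
  exact ENNReal.ofReal_le_of_le_toReal (by rw [← measureReal_def]; linarith)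

theorem ediam_testBall : Metric.ediam testBall = ENNReal.ofReal testDiam := by
  rw [testBall, ← ENNReal.ofReal_toReal Metric.isBounded_closedBall.ediam_ne_top, ← Metric.diam,
    Metric.diam_closedBall_eq _ (half_pos testDiam_pos).le, mul_div_cancel₀ _ two_ne_zero]

theorem testBall_mem_admissibleSets : testBall ∈ admissibleSets 3 := by
  refine ⟨convex_closedBall _ _, ?_, ?_⟩
  · rw [ediam_testBall, cantorGap_eq]
    exact ENNReal.ofReal_le_ofReal (by linarith [one_le_testDiam])
  · rw [ediam_testBall, ediam_cantorProd]
    exact ENNReal.ofReal_le_ofReal (Real.le_sqrt_of_sq_le (by rw [testDiam_sq]; norm_num))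

theorem diamRatio_testBall_le :
    diamRatio 3 testBall ≤ ENNReal.ofReal (testDiam ^ cantorDim 3 * (512 / 453)) := by
  rw [diamRatio_eq, ediam_testBall, ENNReal.ofReal_rpow_of_pos testDiam_pos]
  refine (ENNReal.div_le_div_left le_cantorProb_testBall _).trans_eq ?_
  rw [← ENNReal.ofReal_div_of_pos (by norm_num), div_eq_mul_inv, inv_div]

end TestBall

section OctantCells

/-- The position, in units of `1 / 27`, of a triadic interval of level 3: `v` is the third of the
Cantor set it lies in, and `j` numbers the intervals of that third from the centre outwards. -/
def cellPos (v : Fin 2) (j : Fin 4) : ℕ := if v = 0 then 8 - cellOffset j else 18 + cellOffset j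

theorem exists_eq_cellPos : ∀ p ∈ cantorPositions 3, ∃ v j, p = cellPos v j := by
  decide

theorem cellPos_bounds : ∀ (v : Fin 2) j, 18 * v ≤ cellPos v j ∧ cellPos v j ≤ 18 * v + 8 := by
  decide

theorem cellGap_eq_zero_or_add_cellPos_le : ∀ v w i j, cellGap v w i j = 0 ∨
    cellGap v w i j + 1 + cellPos v i ≤ cellPos w j ∨
    cellGap v w i j + 1 + cellPos w j ≤ cellPos v i := by
  decide

theorem cellGap_sq_le {v w : Fin 2} {i j : Fin 4} {x y : ℝ}
    (hx : 3 ^ 3 * x - cellPos v i ∈ cantorSet) (hy : 3 ^ 3 * y - cellPos w j ∈ cantorSet) :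
    (cellGap v w i j : ℝ) ^ 2 ≤ 729 * (x - y) ^ 2 := by
  obtain ⟨hx0, hx1⟩ := cantorSet_subset_unitInterval hx
  obtain ⟨hy0, hy1⟩ := cantorSet_subset_unitInterval hy
  have hgap : (cellGap v w i j : ℝ) ≤ |27 * (x - y)| := by
    rcases cellGap_eq_zero_or_add_cellPos_le v w i j with h | h | h
    · rw [h, Nat.cast_zero]
      exact abs_nonneg _
    · have : (cellGap v w i j : ℝ) + 1 + cellPos v i ≤ cellPos w j := mod_cast h
      exact le_abs.2 (.inr (by linarith))
    · have : (cellGap v w i j : ℝ) + 1 + cellPos w j ≤ cellPos v i := mod_cast h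
      exact le_abs.2 (.inl (by linarith))
  calc (cellGap v w i j : ℝ) ^ 2 ≤ |27 * (x - y)| ^ 2 := by gcongr
    _ = 729 * (x - y) ^ 2 := by rw [sq_abs]; ring

variable {d : ℕ} {v w : Fin d → Fin 2} {a b : Fin d → Fin 4} {x y : EuclideanSpace ℝ (Fin d)}

/-- The cell of level 3 in the basic cube `v` whose distance from the centre is given by `a`. -/
def octantCell (v : Fin d → Fin 2) (a : Fin d → Fin 4) : Set (EuclideanSpace ℝ (Fin d)) :=
  cantorCell 3 fun k => cellPos (v k) (a k)

theorem octantCell_subset_basicCube : octantCell v a ⊆ basicCube d v := by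
  refine fun x hx => mem_basicCube_iff.2 fun k => ?_
  obtain ⟨h0, h1⟩ := cantorSet_subset_unitInterval (hx k)
  obtain ⟨hlo, hhi⟩ := cellPos_bounds (v k) (a k)
  have hlo' : (18 : ℝ) * ((v k : ℕ) : ℝ) ≤ cellPos (v k) (a k) := mod_cast hlo
  have hhi' : (cellPos (v k) (a k) : ℝ) ≤ 18 * ((v k : ℕ) : ℝ) + 8 := mod_cast hhi
  constructor <;> linarith

theorem exists_mem_octantCell (hx : x ∈ cantorProd d) : ∃ v a, x ∈ octantCell v a := by
  obtain ⟨p, hp, hx⟩ := (mem_cantorProd_iff_exists_cell 3 x).1 hx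
  choose v a h using fun k => exists_eq_cellPos (p k) (Fintype.mem_piFinset.1 hp k)
  exact ⟨v, a, by simpa only [octantCell, ← h] using hx⟩

theorem sum_cellGap_sq_le (hx : x ∈ octantCell v a) (hy : y ∈ octantCell w b) :
    ((∑ k, cellGap (v k) (w k) (a k) (b k) ^ 2 : ℕ) : ℝ) ≤ 729 * dist x y ^ 2 := by
  rw [dist_sq_eq_sum, Finset.mul_sum]
  push_cast
  exact Finset.sum_le_sum fun k _ => cellGap_sq_le (hx k) (hy k)

open Classical in
/-- The indices `a` of the cells `octantCell v a` which `A` meets. -/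
noncomputable def cellsMet (A : Set (EuclideanSpace ℝ (Fin d))) (v : Fin d → Fin 2) :
    Finset (Fin d → Fin 4) :=
  Finset.univ.filter fun a => (A ∩ octantCell v a).Nonempty

theorem mem_cellsMet {A : Set (EuclideanSpace ℝ (Fin d))} :
    a ∈ cellsMet A v ↔ (A ∩ octantCell v a).Nonempty := by
  simp only [cellsMet, Finset.mem_filter, Finset.mem_univ, true_and]

variable {A : Set (EuclideanSpace ℝ (Fin d))}

theorem cellsMet_nonempty_iff (hA : A ⊆ cantorProd d) :
    (cellsMet A v).Nonempty ↔ (A ∩ basicCube d v).Nonempty := by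
  constructor
  · rintro ⟨a, ha⟩
    exact (mem_cellsMet.1 ha).mono (Set.inter_subset_inter_right _ octantCell_subset_basicCube)
  · rintro ⟨x, hxA, hx⟩
    obtain ⟨w, a, ha⟩ := exists_mem_octantCell (hA hxA)
    obtain rfl := eq_of_mem_basicCube (octantCell_subset_basicCube ha) hx
    exact ⟨a, mem_cellsMet.2 ⟨x, hxA, ha⟩⟩

theorem card_filter_cellsMet_nonempty (hA : A ⊆ cantorProd d) :
    (Finset.univ.filter fun v => (cellsMet A v).Nonempty).card = numBasicMet d A := by
  simp only [numBasicMet, ← Set.ncard_coe_finset, Finset.coe_filter, Finset.mem_univ, true_and,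
    cellsMet_nonempty_iff hA]

theorem cantorProb_real_le_sum_card_cellsMet (A : Set (EuclideanSpace ℝ (Fin d))) :
    (cantorProb d).real A ≤
      (∑ v with (cellsMet A v).Nonempty, (cellsMet A v).card : ℕ) / (2 ^ d) ^ 3 := by
  set V := Finset.univ.filter fun v => (cellsMet A v).Nonempty
  have hcover := cantorProb_le_card_mul (A := A) 3 (V.sigma (cellsMet A))
    (fun i k => cellPos (i.1 k) (i.2 k)) fun x ⟨hxA, hxE⟩ => by
      obtain ⟨v, a, ha⟩ := exists_mem_octantCell hxE
      have hmem := mem_cellsMet.2 ⟨x, hxA, ha⟩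
      exact ⟨⟨v, a⟩, Finset.mem_sigma.2
        ⟨Finset.mem_filter.2 ⟨Finset.mem_univ _, a, hmem⟩, hmem⟩, ha⟩
  rw [Finset.card_sigma] at hcover
  refine (ENNReal.toReal_mono (ENNReal.mul_ne_top (ENNReal.natCast_ne_top _) (by simp))
    hcover).trans_eq ?_
  rw [ENNReal.toReal_mul, ENNReal.toReal_natCast, ENNReal.toReal_inv, div_eq_mul_inv]
  simp

end OctantCells

section Efficient

/-- The ratio of `A` is at most the bound for the ratio of the competing ball. Unlike optimality,
this depends only on the diameter and the mass, and so it passes to traces and magnifications. -/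
def IsEfficient (A : Set (EuclideanSpace ℝ (Fin 3))) : Prop :=
  diamRatio 3 A ≤ ENNReal.ofReal (testDiam ^ cantorDim 3 * (512 / 453))

theorem Forces.mul_sq_lt {D : ℝ} {m T : ℕ} (hT : Forces m T) (hD : 0 ≤ D)
    (h : D ^ cantorDim 3 ≤ testDiam ^ cantorDim 3 * (m / 453)) : 729 * D ^ 2 < T := by
  obtain ⟨hT1, hTm⟩ := hT
  by_contra! hTD
  have hT0 : T ≠ 0 := by
    rintro rfl
    simp at hTm
  set s := cantorDim 3
  set x : ℝ := 9 * T / 14515 with hx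
  have hx0 : 0 < x := by positivity
  have hx1 : x ≤ 1 := (div_le_one (by norm_num)).2 (mod_cast hT1)
  have hxD : √x ≤ D / testDiam := by
    refine Real.sqrt_le_iff.2 ⟨div_nonneg hD testDiam_pos.le, ?_⟩
    rw [div_pow, testDiam_sq, hx]
    linarith
  have hxs : √x ^ s ≤ m / 453 := by
    refine (Real.rpow_le_rpow (Real.sqrt_nonneg _) hxD (cantorDim_nonneg 3)).trans ?_
    rwa [Real.div_rpow hD testDiam_pos.le, div_le_iff₀' (Real.rpow_pos_of_pos testDiam_pos _)]
  have hxm : x ^ 53 ≤ (m / 453) ^ 56 := by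
    calc x ^ 53 = x ^ (53 : ℝ) := by rw [← Real.rpow_natCast, Nat.cast_ofNat]
      _ ≤ x ^ (28 * s) :=
          Real.rpow_le_rpow_of_exponent_ge hx0 hx1 twenty_eight_mul_cantorDim_three_le
      _ = (√x ^ s) ^ 56 := by
          rw [Real.sqrt_eq_rpow, ← Real.rpow_mul hx0.le, ← Real.rpow_natCast,
            ← Real.rpow_mul hx0.le]
          congr 1
          push_cast
          ring
      _ ≤ (m / 453) ^ 56 := by gcongr
  rw [div_pow, div_pow, div_le_div_iff₀ (by positivity) (by positivity)] at hxm
  exact hxm.not_gt (mod_cast hTm)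

theorem testDiam_rpow_lt : testDiam ^ cantorDim 3 * (512 / 453 * (1 / 8)) < 1 := by
  have h := Real.rpow_le_rpow_of_exponent_le (z := 2) one_le_testDiam
    (by linarith [twenty_eight_mul_cantorDim_three_le])
  rw [Real.rpow_two, testDiam_sq] at h
  linarith

theorem lt_five_thirds_of_rpow_le {D : ℝ}
    (h : D ^ cantorDim 3 ≤ testDiam ^ cantorDim 3 * (512 / 453)) : D < 5 / 3 := by
  by_contra! hD
  set x := 5 / 3 / testDiam
  have hx0 : 0 ≤ x := div_nonneg (by norm_num) testDiam_pos.le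
  have hxsq : x ^ 2 = 25 / 9 * (6561 / 14515) := by
    rw [div_pow, testDiam_sq]
    norm_num
  have hx1 : 1 ≤ x := (one_le_sq_iff₀ hx0).1 (by rw [hxsq]; norm_num)
  have hxs : x ^ cantorDim 3 ≤ 512 / 453 := by
    rw [Real.div_rpow (by norm_num) testDiam_pos.le,
      div_le_iff₀' (Real.rpow_pos_of_pos testDiam_pos _)]
    exact (Real.rpow_le_rpow (by norm_num) hD (cantorDim_nonneg 3)).trans h
  have hx : (x ^ 2) ^ 3 ≤ (512 / 453) ^ 4 := by
    calc (x ^ 2) ^ 3 = x ^ (6 : ℝ) := by rw [← pow_mul, ← Real.rpow_natCast]; norm_num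
      _ ≤ x ^ (cantorDim 3 * 4) :=
          Real.rpow_le_rpow_of_exponent_le hx1 (by linarith [three_le_two_mul_cantorDim_three])
      _ = (x ^ cantorDim 3) ^ 4 := by rw [Real.rpow_mul hx0, ← Real.rpow_natCast, Nat.cast_ofNat]
      _ ≤ (512 / 453) ^ 4 := by gcongr
  rw [hxsq] at hx
  norm_num at hx

variable {A : Set (EuclideanSpace ℝ (Fin 3))} {i j : Fin 3 → Fin 2}

theorem diam_cantorMap_preimage (i : Fin 3 → Fin 2) (A : Set (EuclideanSpace ℝ (Fin 3))) :
    Metric.diam (cantorMap 3 i ⁻¹' A) = 3 * Metric.diam A := by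
  rw [Metric.diam, ediam_cantorMap_preimage, ENNReal.toReal_mul, Metric.diam,
    ENNReal.toReal_ofNat]

theorem cantorProb_real_le_of_inter_subset_basicCube (hi : A ∩ cantorProd 3 ⊆ basicCube 3 i) :
    (cantorProb 3).real A ≤ 1 / 8 := by
  have h := measureReal_le_one (μ := cantorProb 3) (s := cantorMap 3 i ⁻¹' A)
  rw [measureReal_def, cantorProb_cantorMap_preimage hi, ENNReal.toReal_mul,
    ← measureReal_def] at h
  norm_num at h
  linarith

theorem exists_inter_subset_basicCube (h : numBasicMet 3 (A ∩ cantorProd 3) ≤ 1) :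
    ∃ i, A ∩ cantorProd 3 ⊆ basicCube 3 i := by
  rcases (A ∩ cantorProd 3).eq_empty_or_nonempty with hempty | ⟨x, hx⟩
  · exact ⟨0, hempty ▸ Set.empty_subset _⟩
  obtain ⟨i, hi⟩ := exists_mem_basicCube hx.2
  refine ⟨i, fun y hy => ?_⟩
  obtain ⟨j, hj⟩ := exists_mem_basicCube hy.2
  rwa [(Set.ncard_le_one_iff (Set.toFinite _)).1 h ⟨x, hx, hi⟩ ⟨y, hy, hj⟩]

theorem numBasicMet_le_four {k : Fin 3} {c : Fin 2}
    (h : ∀ v, (A ∩ basicCube 3 v).Nonempty → v k = c) : numBasicMet 3 A ≤ 4 := by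
  have hcard : ∀ (k : Fin 3) (c : Fin 2),
      (Finset.univ.filter fun v : Fin 3 → Fin 2 => v k = c).card = 4 := by decide
  rw [← hcard k c, ← Set.ncard_coe_finset]
  exact Set.ncard_le_ncard (fun v hv => by simpa using h v hv) (Set.toFinite _)

theorem numBasicMet_cantorMap_preimage_le_four (hA : ∀ x ∈ A, ∀ y ∈ A, dist x y < 5 / 9)
    (hji : j ≠ i) (hj : (A ∩ basicCube 3 j).Nonempty) :
    numBasicMet 3 (cantorMap 3 i ⁻¹' A) ≤ 4 := by
  obtain ⟨y, hyA, hy⟩ := hj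
  obtain ⟨k, hk⟩ := Function.ne_iff.1 hji
  refine numBasicMet_le_four (k := k) (c := j k) ?_
  rintro v ⟨x, hxA, hx⟩
  have hxy := abs_lt.1 ((abs_sub_le_dist _ _ k).trans_lt (hA _ hxA y hyA))
  rw [cantorMap_apply] at hxy
  obtain ⟨hx0, hx1⟩ := mem_basicCube_iff.1 hx k
  obtain ⟨hy0, hy1⟩ := mem_basicCube_iff.1 hy k
  by_contra hvj
  rcases (show (i k = 0 ∧ j k = 1 ∧ v k = 0) ∨ (i k = 1 ∧ j k = 0 ∧ v k = 1) by omega)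
    with ⟨hi, hj, hv⟩ | ⟨hi, hj, hv⟩ <;>
    simp only [hi, hj, hv, Fin.val_zero, Fin.val_one, Nat.cast_zero, Nat.cast_one] at * <;>
    linarith

namespace IsEfficient

theorem inter_cantorProd (h : IsEfficient A) : IsEfficient (A ∩ cantorProd 3) := by
  refine le_trans ?_ h
  rw [diamRatio_eq, diamRatio_eq, cantorProb_inter]
  gcongr
  · exact cantorDim_nonneg 3
  · exact Set.inter_subset_left

theorem cantorMap_preimage (h : IsEfficient A) (hi : A ∩ cantorProd 3 ⊆ basicCube 3 i) :
    IsEfficient (cantorMap 3 i ⁻¹' A) :=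
  (diamRatio_cantorMap_preimage hi).trans_le h

theorem ediam_rpow_le (h : IsEfficient A) : Metric.ediam A ^ cantorDim 3 ≤
    ENNReal.ofReal (testDiam ^ cantorDim 3 * (512 / 453)) * cantorProb 3 A := by
  have hpos : 0 < testDiam ^ cantorDim 3 * (512 / 453) :=
    mul_pos (Real.rpow_pos_of_pos testDiam_pos _) (by norm_num)
  rwa [IsEfficient, diamRatio_eq, ENNReal.div_le_iff_le_mul (.inr ENNReal.ofReal_ne_top)
    (.inr (ENNReal.ofReal_pos.2 hpos).ne')] at h

theorem isBounded (h : IsEfficient A) : Bornology.IsBounded A := by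
  rw [Metric.isBounded_iff_ediam_ne_top]
  intro htop
  have hle := h.ediam_rpow_le
  rw [htop, ENNReal.top_rpow_of_pos (cantorDim_pos 3), top_le_iff] at hle
  exact ENNReal.mul_ne_top ENNReal.ofReal_ne_top (measure_ne_top _ _) hle

theorem diam_rpow_le (h : IsEfficient A) : Metric.diam A ^ cantorDim 3 ≤
    testDiam ^ cantorDim 3 * (512 / 453 * (cantorProb 3).real A) := by
  have hle := ENNReal.toReal_mono
    (ENNReal.mul_ne_top ENNReal.ofReal_ne_top (measure_ne_top _ _)) h.ediam_rpow_le
  have hpos := Real.rpow_pos_of_pos testDiam_pos (cantorDim 3)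
  rwa [← ENNReal.toReal_rpow, ENNReal.toReal_mul, ENNReal.toReal_ofReal (by positivity),
    mul_assoc] at hle

theorem diam_lt_five_thirds (h : IsEfficient A) : Metric.diam A < 5 / 3 := by
  have hpos := Real.rpow_pos_of_pos testDiam_pos (cantorDim 3)
  refine lt_five_thirds_of_rpow_le (h.diam_rpow_le.trans ?_)
  exact mul_le_mul_of_nonneg_left (mul_le_of_le_one_right (by norm_num) measureReal_le_one) hpos.le

theorem not_inter_subset_basicCube (h : IsEfficient A) (hdiam : 1 ≤ Metric.diam A) :
    ¬ A ∩ cantorProd 3 ⊆ basicCube 3 i := by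
  intro hi
  have hpos := Real.rpow_pos_of_pos testDiam_pos (cantorDim 3)
  have hmass := cantorProb_real_le_of_inter_subset_basicCube hi
  have : 1 ≤ testDiam ^ cantorDim 3 * (512 / 453 * (1 / 8)) := by
    refine (Real.one_le_rpow hdiam (cantorDim_nonneg 3)).trans (h.diam_rpow_le.trans ?_)
    gcongr
  exact this.not_gt testDiam_rpow_lt

theorem four_lt_numBasicMet (h : IsEfficient A) (hA : A ⊆ cantorProd 3)
    (h2 : 2 ≤ numBasicMet 3 A) : 4 < numBasicMet 3 A := by
  rw [← card_filter_cellsMet_nonempty hA] at h2 ⊢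
  refine four_lt_card_of_forces h2 (fun v hv => (Finset.mem_filter.1 hv).2)
    fun T hT v w a ha b hb => ?_
  obtain ⟨x, hxA, hx⟩ := mem_cellsMet.1 ha
  obtain ⟨y, hyA, hy⟩ := mem_cellsMet.1 hb
  have hdiam : 729 * Metric.diam A ^ 2 < T := by
    refine hT.mul_sq_lt Metric.diam_nonneg (h.diam_rpow_le.trans ?_)
    have hpos := Real.rpow_pos_of_pos testDiam_pos (cantorDim 3)
    have hmass := cantorProb_real_le_sum_card_cellsMet A
    refine mul_le_mul_of_nonneg_left ?_ hpos.le
    linarith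
  have hxy : dist x y ^ 2 ≤ Metric.diam A ^ 2 := by
    gcongr
    exact Metric.dist_le_diam_of_mem h.isBounded hxA hyA
  have := (sum_cellGap_sq_le hx hy).trans_lt (lt_of_le_of_lt (by gcongr) hdiam)
  exact_mod_cast this

theorem five_le_numBasicMet_inter (h : IsEfficient A) (hdiam : 1 ≤ Metric.diam A) :
    5 ≤ numBasicMet 3 (A ∩ cantorProd 3) := by
  refine h.inter_cantorProd.four_lt_numBasicMet Set.inter_subset_right ?_
  by_contra! hlt
  obtain ⟨i, hi⟩ := exists_inter_subset_basicCube (Nat.le_of_lt_succ hlt)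
  exact h.not_inter_subset_basicCube hdiam hi

theorem five_le_numBasicMet_cantorMap_preimage (h : IsEfficient A) (hdiam : 1 / 3 ≤ Metric.diam A)
    (hi : A ∩ cantorProd 3 ⊆ basicCube 3 i) : 5 ≤ numBasicMet 3 (cantorMap 3 i ⁻¹' A) := by
  refine ((h.cantorMap_preimage hi).five_le_numBasicMet_inter ?_).trans
    (numBasicMet_mono Set.inter_subset_left)
  rw [diam_cantorMap_preimage]
  linarith

theorem diam_lt_five_ninths (h : IsEfficient A) (hi : A ∩ cantorProd 3 ⊆ basicCube 3 i) :
    Metric.diam A < 5 / 9 := by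
  have := (h.cantorMap_preimage hi).diam_lt_five_thirds
  rw [diam_cantorMap_preimage] at this
  linarith

theorem five_le_numBasicMet (h : IsEfficient A) (hdiam : 1 / 3 ≤ Metric.diam A)
    (h2 : 2 ≤ numBasicMet 3 A) : 5 ≤ numBasicMet 3 A := by
  rcases le_or_gt 2 (numBasicMet 3 (A ∩ cantorProd 3)) with htrace | htrace
  · exact (h.inter_cantorProd.four_lt_numBasicMet Set.inter_subset_right htrace).trans_le
      (numBasicMet_mono Set.inter_subset_left)
  · exfalso
    obtain ⟨i, hi⟩ := exists_inter_subset_basicCube (Nat.le_of_lt_succ htrace)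
    obtain ⟨j, hj, hji⟩ := Set.exists_ne_of_one_lt_ncard h2 i
    have hsmall : ∀ x ∈ A, ∀ y ∈ A, dist x y < 5 / 9 := fun x hx y hy =>
      (Metric.dist_le_diam_of_mem h.isBounded hx hy).trans_lt (h.diam_lt_five_ninths hi)
    exact (numBasicMet_cantorMap_preimage_le_four hsmall hji hj).not_gt
      (h.five_le_numBasicMet_cantorMap_preimage hdiam hi)

end IsEfficient

end Efficient

section Optimal

theorem convex_cantorMap_preimage {d : ℕ} {A : Set (EuclideanSpace ℝ (Fin d))} (hA : Convex ℝ A)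
    (i : Fin d → Fin 2) : Convex ℝ (cantorMap d i ⁻¹' A) := by
  intro x hx y hy a b ha hb hab
  have hcomb : cantorMap d i (a • x + b • y) = a • cantorMap d i x + b • cantorMap d i y := by
    ext k
    simp only [cantorMap_apply, PiLp.add_apply, PiLp.smul_apply, smul_eq_mul]
    linear_combination (2 / 3 * ((i k : ℕ) : ℝ)) * (-hab)
  rw [Set.mem_preimage, hcomb]
  exact hA hx hy ha hb hab

theorem IsOptimalSet.cantorMap_preimage {d : ℕ} {A : Set (EuclideanSpace ℝ (Fin d))}
    {i : Fin d → Fin 2} (h : IsOptimalSet d A) (hi : A ∩ cantorProd d ⊆ basicCube d i)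
    (hdiam : 3 * Metric.ediam A ≤ Metric.ediam (cantorProd d)) :
    IsOptimalSet d (cantorMap d i ⁻¹' A) := by
  have hediam := ediam_cantorMap_preimage i A
  refine ⟨⟨convex_cantorMap_preimage h.1.1 i, ?_, hediam ▸ hdiam⟩, fun B hB => ?_⟩
  · rw [hediam]
    exact h.1.2.1.trans (le_mul_of_one_le_left' (by norm_num))
  · exact (diamRatio_cantorMap_preimage hi).trans_le (h.2 hB)

namespace IsOptimalSet

variable {A : Set (EuclideanSpace ℝ (Fin 3))}

theorem isEfficient (h : IsOptimalSet 3 A) : IsEfficient A :=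
  (h.2 testBall_mem_admissibleSets).trans diamRatio_testBall_le

theorem third_le_diam (h : IsOptimalSet 3 A) : 1 / 3 ≤ Metric.diam A := by
  rw [← cantorGap_eq 3, Metric.diam,
    ← ENNReal.ofReal_le_iff_le_toReal (ediam_ne_top_of_mem_admissibleSets h.1)]
  exact h.1.2.1

theorem five_le_numBasicMet (h : IsOptimalSet 3 A) (h2 : 2 ≤ numBasicMet 3 A) :
    5 ≤ numBasicMet 3 A :=
  h.isEfficient.five_le_numBasicMet h.third_le_diam h2

theorem exists_magnification (h : IsOptimalSet 3 A) (h2 : numBasicMet 3 A < 2) :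
    ∃ i, A ∩ cantorProd 3 ⊆ basicCube 3 i ∧ IsOptimalSet 3 (cantorMap 3 i ⁻¹' A) ∧
      5 ≤ numBasicMet 3 (cantorMap 3 i ⁻¹' A) := by
  obtain ⟨i, hi⟩ := exists_inter_subset_basicCube
    ((numBasicMet_mono Set.inter_subset_left).trans (Nat.le_of_lt_succ h2))
  refine ⟨i, hi, h.cantorMap_preimage hi ?_,
    h.isEfficient.five_le_numBasicMet_cantorMap_preimage h.third_le_diam hi⟩
  have hsmall := h.isEfficient.diam_lt_five_ninths hi
  rw [← ediam_cantorMap_preimage i A, ediam_cantorProd, ediam_cantorMap_preimage,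
    ← ENNReal.ofReal_toReal (ediam_ne_top_of_mem_admissibleSets h.1), ← ENNReal.ofReal_ofNat,
    ← ENNReal.ofReal_mul zero_le_three]
  refine ENNReal.ofReal_le_ofReal (Real.le_sqrt_of_sq_le ?_)
  have hdiam := h.third_le_diam
  rw [Metric.diam] at hsmall hdiam
  push_cast
  nlinarith

end IsOptimalSet

end Optimal

theorem mainTheorem5 :
    (∃ A : Set (EuclideanSpace ℝ (Fin 3)), IsOptimalSet 3 A ∧ 5 ≤ numBasicMet 3 A) ∧
    (∀ A : Set (EuclideanSpace ℝ (Fin 3)), IsOptimalSet 3 A → 2 ≤ numBasicMet 3 A →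
      5 ≤ numBasicMet 3 A) ∧
    (∀ A : Set (EuclideanSpace ℝ (Fin 3)), IsOptimalSet 3 A → numBasicMet 3 A < 2 →
      ∃ i : Fin 3 → Fin 2, A ∩ cantorProd 3 ⊆ basicCube 3 i ∧
        IsOptimalSet 3 (cantorMap 3 i ⁻¹' A) ∧ 5 ≤ numBasicMet 3 (cantorMap 3 i ⁻¹' A)) := by
  refine ⟨?_, fun A hA => hA.five_le_numBasicMet, fun A hA => hA.exists_magnification⟩
  obtain ⟨A, hA⟩ := exists_isOptimalSet 3
  rcases le_or_gt 2 (numBasicMet 3 A) with h2 | h2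
  · exact ⟨A, hA, hA.five_le_numBasicMet h2⟩
  · obtain ⟨i, -, hopt, h5⟩ := hA.exists_magnification h2
    exact ⟨cantorMap 3 i ⁻¹' A, hopt, h5⟩
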